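/- **($\Gamma$-convergence of objective functionals of learning problems.)** Let $T>0$, $p\in[1,+\infty)$, $m,n\in\mathbb N$, $b\in\mathbb R^m$, $x^0,y\in\mathbb R^n$ and $\beta_1,\beta_2,\beta_3\ge 0$. Let $\|\cdot\|_2$ be the Euclidean norm on vectors and the spectral norm on matrices, equip $\mathbb R^{m\times n}\times\mathbb R\times\mathbb R$ with the norm $\|U\|_2+|\eta|+|\zeta|$, and assume: - (A1) $\mathcal R:\mathbb R^n\to\mathbb R$ is convex, with subdifferential $\partial\mathcal R$; - (A2) $0\in(\partial\mathcal R)(0)$; - (A3) there is $M>0$ such that for each $x\in\mathbb R^n$ either $\sup\{\|z\|_2: z\in(\partial\mathcal R)(x)\}\le M\|x\|_2$ or $\sup\{\|z\|_2: z\in(\partial\mathcal R)(x)\}\le M$; - (A4) $\mathcal L:\mathbb R^n\times\mathbb R^n\to\mathbb R$ is continuous and nonnegative; - (A5) $\psi:\mathbb R\to[0,+\infty)$ is locally Lipschitz continuous. For parameters $A^{k}\in\mathbb R^{m\times n}$, $\alpha^{k},\lambda^{k}\ge 0$ $(0\le k\le N-1)$ of an $N$-layer network, $N\ge1$, let $x^{N,0},\dots,x^{N,N}$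 be the state with $x^{N,0}=x^0$ and $$0\in x^{N,k+1}-x^{N,k}+\tfrac TN\alpha^{k}(A^{k})^\top(A^{k}x^{N,k}-b)+\tfrac TN\alpha^{k}\lambda^{k}(\partial\mathcal R)(x^{N,k+1}),\qquad 0\le k\le N-1,$$ and set $$\mathcal J_N(A,\alpha,\lambda)=\mathcal L(x^{N,N};y)+\beta_1\psi\Big(\tfrac1N\sum_{k<N}\|A^{k}\|_2^p\Big)+\beta_2\psi\Big(\tfrac1N\sum_{k<N}|\alpha^{k}|^p\Big)+\beta_3\psi\Big(\tfrac1N\sum_{k<N}|\lambda^{k}|^p\Big).$$ For $(\pmb A,\pmb\alpha,\pmb\lambda)\in L^\infty([0,T];\mathbb R^{m\times n}\times\mathbb R\times\mathbb R)$ with $\pmb\alpha,\pmb\lambda\ge0$ a.e., let $\pmb x:[0,T]\to\mathbb R^n$ be the absolutely continuous solution of $$0\in\dot{\pmb x}(t)+\pmb\alpha(t)\pmb A(t)^\top(\pmb A(t)\pmb x(t)-b)+\pmb\alpha(t)\pmb\lambda(t)(\partial\mathcal R)(\pmb x(t))\ \text{ for a.e. }t\in[0,T],\qquad \pmb x(0)=x^0,$$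 and set $$\mathcal J(\pmb A,\pmb\alpha,\pmb\lambda)=\mathcal L(\pmb x(T);y)+\beta_1\psi\Big(\tfrac1T\int_0^T\|\pmb A\|_2^p\,dt\Big)+\beta_2\psi\Big(\tfrac1T\int_0^T|\pmb\alpha|^p\,dt\Big)+\beta_3\psi\Big(\tfrac1T\int_0^T|\pmb\lambda|^p\,dt\Big).$$ Let $\mathcal P_N$ map a function on $[0,T]$ to the $N$-tuple of its mean values over the $N$ consecutive subintervals of $[0,T]$ of length $T/N$ (componentwise on triples). Let $\pmb{\mathscr F}\subset L^\infty([0,T];\mathbb R^{m\times n}\times\mathbb R\times\mathbb R)$ be nonempty, bounded in $L^\infty$, closed in $L^p([0,T];\mathbb R^{m\times n}\times\mathbb R\times\mathbb R)$, and such that $\pmb\alpha,\pmb\lambda\ge0$ a.e. for all $(\pmb A,\pmb\alpha,\pmb\lambda)\in\pmb{\mathscr F}$. Then for every $(\pmb A,\pmb\alpha,\pmb\lambda)\in\pmb{\mathscr F}$ the state $\pmb x$ exists and is unique on $[0,T]$, and for every $N\ge1$ the network state with parameters $(\mathcal P_N\pmb A,\mathcal P_N\pmb\alpha,\mathcal P_N\pmb\lambda)$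 exists and is unique, so that $\mathcal J$ and $\mathcal J_N\circ\mathcal P_N$ are well defined on $\pmb{\mathscr F}$. Let $\overline{\mathcal J}$ and $\overline{\mathcal J_N\circ\mathcal P_N}$ be their extensions to $L^p([0,T];\mathbb R^{m\times n}\times\mathbb R\times\mathbb R)$ by $+\infty$ outside $\pmb{\mathscr F}$. Then $$\overline{\mathcal J}=\Gamma\text{-}\lim_{N\to+\infty}\overline{\mathcal J_N\circ\mathcal P_N}\quad\text{over }L^p([0,T];\mathbb R^{m\times n}\times\mathbb R\times\mathbb R),$$ that is: (a) for every $u\in L^p$ and every sequence $u^N\to u$ in $L^p$, $\overline{\mathcal J}(u)\le\liminf_{N\to+\infty}\overline{\mathcal J_N\circ\mathcal P_N}(u^N)$; (b) for every $u\in L^p$ there is a sequence $u^N\to u$ in $L^p$ with $\overline{\mathcal J}(u)\ge\limsup_{N\to+\infty}\overline{\mathcal J_N\circ\mathcal P_N}(u^N)$. -/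

import Mathlib

open MeasureTheory Set Filter Topology
open scoped ENNReal Matrix.Norms.L2Operator

/-- `ℝⁿ` with the Euclidean norm. -/
abbrev Vec (n : ℕ) : Type := EuclideanSpace ℝ (Fin n)

/-- `ℝ^{m × n}`; its norm is the spectral norm `‖·‖₂` (the operator norm between Euclidean
spaces). -/
abbrev Mat (m n : ℕ) : Type := Matrix (Fin m) (Fin n) ℝ

/-- `ℝ^{m × n} × ℝ × ℝ` with the norm `‖(U, η, ζ)‖ = ‖U‖₂ + |η| + |ζ|`. -/
abbrev Param (m n : ℕ) : Type := WithLp 1 (Mat m n × WithLp 1 (ℝ × ℝ))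

namespace Param

variable {m n : ℕ}

/-- The matrix component `A` of `(A, α, λ)`. -/
def matPart (v : Param m n) : Mat m n := v.fst

/-- The step-size component `α` of `(A, α, λ)`. -/
def stepPart (v : Param m n) : ℝ := v.snd.fst

/-- The regularization component `λ` of `(A, α, λ)`. -/
def regPart (v : Param m n) : ℝ := v.snd.snd

theorem norm_eq (v : Param m n) : ‖v‖ = ‖v.matPart‖ + |v.stepPart| + |v.regPart| := by
  rw [WithLp.prod_norm_eq_add (by norm_num), WithLp.prod_norm_eq_add (by norm_num)]
  simp [matPart, stepPart, regPart, add_assoc]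

end Param

noncomputable section

/-- The convex subdifferential `(∂R)(x)`. -/
def subdiff {n : ℕ} (R : Vec n → ℝ) (x : Vec n) : Set (Vec n) :=
  {g | ∀ z, R x + inner ℝ g (z - x) ≤ R z}

/-- The gradient of the data term, `Aᵀ (A x - b)`. -/
def dataGrad {m n : ℕ} (A : Mat m n) (b : Vec m) (x : Vec n) : Vec n :=
  A.transpose.toEuclideanLin (A.toEuclideanLin x - b)

/-- `x^{N,0}, …, x^{N,N}` is the state of the `N`-layer FBS-network with parameters
`(A^{N,k}, α^{N,k}, λ^{N,k})`, `k = 0, …, N-1`, step `h = T / N` and initial value `x₀`: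
`0 ∈ x^{k+1} - x^k + h α^k (A^k)ᵀ (A^k x^k - b) + h α^k λ^k (∂R)(x^{k+1})`. -/
def IsNetworkState {m n : ℕ} (R : Vec n → ℝ) (T : ℝ) (b : Vec m) (x₀ : Vec n) {N : ℕ}
    (A : Fin N → Mat m n) (α lam : Fin N → ℝ) (x : Fin (N + 1) → Vec n) : Prop :=
  x 0 = x₀ ∧
  ∀ k : Fin N, ∃ g ∈ subdiff R (x k.succ),
    x k.succ - x k.castSucc + (T / N * α k) • dataGrad (A k) b (x k.castSucc)
      + (T / N * α k * lam k) • g = 0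

/-- `x` is an absolutely continuous solution on `[0,T]` of the deep-layer limit system
`0 ∈ ẋ(t) + α(t) A(t)ᵀ (A(t) x(t) - b) + α(t) λ(t) (∂R)(x(t))` for a.e. `t`, `x(0) = x₀`. -/
def IsLimitState {m n : ℕ} (R : Vec n → ℝ) (T : ℝ) (b : Vec m) (x₀ : Vec n)
    (A : ℝ → Mat m n) (α lam : ℝ → ℝ) (x : ℝ → Vec n) : Prop :=
  AbsolutelyContinuousOnInterval x 0 T ∧ x 0 = x₀ ∧
  ∀ᵐ t ∂(volume.restrict (Icc 0 T)), ∃ v, HasDerivAt x v t ∧ ∃ g ∈ subdiff R (x t),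
    v + α t • dataGrad (A t) b (x t) + (α t * lam t) • g = 0

open Classical in
/-- The output `x^{N,N}` of the FBS-network (the value `0` is used only when there is no
state). -/
def networkOutput {m n : ℕ} (R : Vec n → ℝ) (T : ℝ) (b : Vec m) (x₀ : Vec n) {N : ℕ}
    (A : Fin N → Mat m n) (α lam : Fin N → ℝ) : Vec n :=
  if h : ∃ x, IsNetworkState R T b x₀ A α lam x then h.choose (Fin.last N) else 0

open Classical in
/-- The terminal value `x(T)` of the deep-layer limit system (the value `0` is used only when
there is no solution). -/
def limitOutput {m n : ℕ} (R : Vec n → ℝ) (T : ℝ) (b : Vec m) (x₀ : Vec n)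
    (A : ℝ → Mat m n) (α lam : ℝ → ℝ) : Vec n :=
  if h : ∃ x, IsLimitState R T b x₀ A α lam x then h.choose T else 0

/-- `ψ((1/N) ∑_{k<N} ‖V_k‖^p)`. -/
def discreteReg {E : Type*} [Norm E] (ψ : ℝ → ℝ) (p : ℝ) {N : ℕ} (V : Fin N → E) : ℝ :=
  ψ (1 / N * ∑ k, ‖V k‖ ^ p)

/-- `ψ((1/T) ∫_{[0,T]} ‖V(t)‖^p dt)`. -/
def continuousReg {E : Type*} [Norm E] (ψ : ℝ → ℝ) (p T : ℝ) (V : ℝ → E) : ℝ :=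
  ψ (1 / T * ∫ t in Icc 0 T, ‖V t‖ ^ p)

/-- The objective `𝒥_N` of the learning problem of the `N`-layer FBS-network. -/
def networkObjective {m n : ℕ} (R : Vec n → ℝ) (L : Vec n → Vec n → ℝ) (ψ : ℝ → ℝ)
    (β₁ β₂ β₃ p T : ℝ) (b : Vec m) (x₀ y : Vec n) {N : ℕ}
    (A : Fin N → Mat m n) (α lam : Fin N → ℝ) : ℝ :=
  L (networkOutput R T b x₀ A α lam) y
    + β₁ * discreteReg ψ p A + β₂ * discreteReg ψ p α + β₃ * discreteReg ψ p lam

/-- The objective `𝒥` of the learning problem of the deep-layer limit system. -/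
def limitObjective {m n : ℕ} (R : Vec n → ℝ) (L : Vec n → Vec n → ℝ) (ψ : ℝ → ℝ)
    (β₁ β₂ β₃ p T : ℝ) (b : Vec m) (x₀ y : Vec n)
    (A : ℝ → Mat m n) (α lam : ℝ → ℝ) : ℝ :=
  L (limitOutput R T b x₀ A α lam) y
    + β₁ * continuousReg ψ p T A + β₂ * continuousReg ψ p T α + β₃ * continuousReg ψ p T lam

/-- The `k`-th cell `Ω_k^N` of the partition of `[0,T]` into `N` intervals of length `T / N`,
half-open except for the last one, which is closed. -/
def cell (T : ℝ) (N : ℕ) (k : Fin N) : Set ℝ :=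
  if (k : ℕ) + 1 = N then Icc ((k : ℕ) * (T / N)) T
  else Ico ((k : ℕ) * (T / N)) (((k : ℕ) + 1) * (T / N))

/-- The projection `(𝒫_N V)_k = |Ω_k^N|⁻¹ ∫_{Ω_k^N} V(s) ds`. -/
def proj {E : Type*} [NormedAddCommGroup E] [NormedSpace ℝ E] (T : ℝ) (N : ℕ) (V : ℝ → E)
    (k : Fin N) : E :=
  ⨍ s in cell T N k, V s

/-- `L^p([0,T]; ℝ^{m × n} × ℝ × ℝ)`. -/
abbrev Control (m n : ℕ) (p : ℝ≥0∞) (T : ℝ) : Type :=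
  Lp (Param m n) p (volume.restrict (Icc 0 T))

namespace Control

variable {m n : ℕ} {p : ℝ≥0∞} {T : ℝ}

/-- The component `A` of the control `(A, α, λ)`. -/
def A (u : Control m n p T) (t : ℝ) : Mat m n := (u t).matPart

/-- The component `α` of the control `(A, α, λ)`. -/
def α (u : Control m n p T) (t : ℝ) : ℝ := (u t).stepPart

/-- The component `λ` of the control `(A, α, λ)`. -/
def lam (u : Control m n p T) (t : ℝ) : ℝ := (u t).regPart

end Control

open Classical in
/-- The extension of a real-valued functional by `+∞` outside `𝓕`. -/
def extendTop {X : Type*} (𝓕 : Set X) (J : X → ℝ) (u : X) : EReal :=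
  if u ∈ 𝓕 then (J u : EReal) else ⊤

/-- Sequential `Γ`-convergence of `F 0, F 1, …` to `G`, in a first countable space. -/
def GammaConverges {X : Type*} [TopologicalSpace X] [FirstCountableTopology X]
    (F : ℕ → X → EReal) (G : X → EReal) : Prop :=
  (∀ (x : X) (u : ℕ → X), Tendsto u atTop (𝓝 x) →
      G x ≤ liminf (fun k => F k (u k)) atTop) ∧
  (∀ x : X, ∃ u : ℕ → X, Tendsto u atTop (𝓝 x) ∧
      limsup (fun k => F k (u k)) atTop ≤ G x)

end

/-! ### Convex subdifferentials and proximal steps -/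

section Convex

variable {n : ℕ} {R : Vec n → ℝ}

/-! A stronger statement than Γ-convergence holds: if controls `v k` in `𝓕` converge to `u` in
`L^p`, then the network objectives at the projected `v k` converge to the limit objective at `u`.
For a closed `𝓕` this gives both Γ-inequalities, with constant recovery sequences
(`gammaConverges_extendTop`). On a bounded interval `L^p` convergence implies `L¹` convergence, and
averaging over cells is an `L¹` contraction that converges to the identity as the mesh shrinks, so
the step functions of the projected parameters still converge to `u` in `L¹`
(`tendsto_integral_norm_stepFun_cellMean_sub_of_tendsto`). Since the controls are uniformly bounded,
continuous integrands preserve this convergence (`tendsto_integral_abs_comp_sub`), which settles the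
three regularization terms.

For the outputs, the inclusion is replaced by an evolution variational inequality: for each test
point `z`, the increment of `½‖x - z‖²` is at most the integral of `eviRate`. This form contains
neither a derivative nor a choice of subgradients, and its integrand is continuous in the parameters
and the state. Network states satisfy it up to an error `O(h²)` per layer, and are bounded with
increments `O(h)`, uniformly in the number of layers (`exists_discreteState_estimates`). Along an
ultrafilter they therefore converge uniformly to a Lipschitz curve
(`exists_lipschitz_ultrafilter_limit`), which inherits the inequality; differentiating it recovers
the inclusion (`isLimitState_of_antitoneOn`).

Applied to a constant sequence of controls, this proves existence of the limit state. Uniqueness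
follows from monotonicity of the subdifferential and of the data gradient (`IsLimitState.eqOn`). It
makes the limit independent of the ultrafilter, so the outputs converge along the whole sequence. -/

theorem ConvexOn.continuous_of_univ (hR : ConvexOn ℝ univ R) : Continuous R :=
  hR.locallyLipschitz.continuous

theorem inner_sub_sub_nonneg_of_mem_subdiff {x y g g' : Vec n} (hg : g ∈ subdiff R x)
    (hg' : g' ∈ subdiff R y) : 0 ≤ inner ℝ (g - g') (x - y) := by
  have h1 := hg y
  have h2 := hg' x
  rw [← neg_sub x y, inner_neg_right] at h1
  rw [inner_sub_left]
  linarith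

theorem inner_nonneg_of_mem_subdiff (h0 : (0 : Vec n) ∈ subdiff R 0) {x g : Vec n}
    (hg : g ∈ subdiff R x) : 0 ≤ inner ℝ g x := by
  simpa using inner_sub_sub_nonneg_of_mem_subdiff hg h0

theorem le_of_zero_mem_subdiff (h0 : (0 : Vec n) ∈ subdiff R 0) (z : Vec n) : R 0 ≤ R z := by
  simpa using h0 z

/-- The proximal objective attains its minimum. -/
theorem exists_forall_prox_le (hR : ConvexOn ℝ univ R) (h0 : (0 : Vec n) ∈ subdiff R 0)
    {c : ℝ} (hc : 0 ≤ c) (w : Vec n) :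
    ∃ x, ∀ z, 1 / 2 * ‖x - w‖ ^ 2 + c * R x ≤ 1 / 2 * ‖z - w‖ ^ 2 + c * R z := by
  have hcont : Continuous fun z : Vec n => 1 / 2 * ‖z - w‖ ^ 2 + c * R z := by
    have := hR.continuous_of_univ
    fun_prop
  -- Coercivity comes from the quadratic term alone, since `R` is bounded below by `R 0`.
  refine hcont.exists_forall_le (tendsto_atTop_mono (f := fun z : Vec n =>
    1 / 2 * (‖z‖ - ‖w‖) ^ 2 + c * R 0) (fun z => ?_) ?_)
  · have h1 := mul_le_mul_of_nonneg_left (le_of_zero_mem_subdiff h0 z) hc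
    have h2 : |‖z‖ - ‖w‖| ≤ ‖z - w‖ := abs_norm_sub_norm_le z w
    have h3 := sq_le_sq' (by linarith [abs_nonneg (‖z‖ - ‖w‖), norm_nonneg (z - w)]) h2
    rw [sq_abs] at h3
    linarith
  · refine tendsto_atTop_add_const_right _ _ (Tendsto.const_mul_atTop (by norm_num) ?_)
    refine (tendsto_pow_atTop two_ne_zero).comp ?_
    exact tendsto_atTop_add_const_right _ (-‖w‖) (tendsto_norm_cocompact_atTop (E := Vec n))

/-- Compare the minimizer `x` with `x + t (z - x)`, use convexity of `R` on the segment, divide by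
`t` and let `t → 0`. No differentiability of `R` is needed. -/
theorem inner_add_mul_nonneg_of_forall_prox_le (hR : ConvexOn ℝ univ R) {c : ℝ} (hc : 0 ≤ c)
    {w x : Vec n}
    (hx : ∀ z, 1 / 2 * ‖x - w‖ ^ 2 + c * R x ≤ 1 / 2 * ‖z - w‖ ^ 2 + c * R z) (z : Vec n) :
    0 ≤ inner ℝ (x - w) (z - x) + c * (R z - R x) := by
  have key : ∀ t ∈ Ioo (0 : ℝ) 1,
      0 ≤ inner ℝ (x - w) (z - x) + c * (R z - R x) + t * (1 / 2 * ‖z - x‖ ^ 2) := by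
    intro t ht
    have h1 := hx (x + t • (z - x))
    have h2 : R (x + t • (z - x)) ≤ (1 - t) * R x + t * R z := by
      have := hR.2 (mem_univ x) (mem_univ z) (show 0 ≤ 1 - t by linarith [ht.2])
        ht.1.le (by ring)
      simp only [smul_eq_mul] at this
      rwa [show x + t • (z - x) = (1 - t) • x + t • z by module]
    have h3 : ‖x + t • (z - x) - w‖ ^ 2
        = ‖x - w‖ ^ 2 + 2 * (t * inner ℝ (x - w) (z - x)) + t ^ 2 * ‖z - x‖ ^ 2 := by
      rw [show x + t • (z - x) - w = (x - w) + t • (z - x) by abel, norm_add_sq_real,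
        inner_smul_right, norm_smul, mul_pow, Real.norm_eq_abs, sq_abs]
    rw [h3] at h1
    have h4 := mul_le_mul_of_nonneg_left h2 hc
    have : 0 ≤ t * (inner ℝ (x - w) (z - x) + c * (R z - R x) + t * (1 / 2 * ‖z - x‖ ^ 2)) := by
      nlinarith
    exact nonneg_of_mul_nonneg_right this ht.1
  have hlim : Tendsto (fun t : ℝ => inner ℝ (x - w) (z - x) + c * (R z - R x)
      + t * (1 / 2 * ‖z - x‖ ^ 2)) (𝓝[>] 0)
      (𝓝 (inner ℝ (x - w) (z - x) + c * (R z - R x) + 0 * (1 / 2 * ‖z - x‖ ^ 2))) :=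
    (Continuous.tendsto (by fun_prop) 0).mono_left nhdsWithin_le_nhds
  rw [zero_mul, add_zero] at hlim
  refine ge_of_tendsto hlim ?_
  filter_upwards [Ioo_mem_nhdsGT (zero_lt_one' ℝ)] with t ht using key t ht

/-- Dividing the optimality inequality by `c` exhibits `c⁻¹ (w - x)` as a subgradient at the
minimizer. This requires `c > 0` but not nonemptiness of the subdifferential, which is later derived
from it. -/
theorem exists_prox_of_pos (hR : ConvexOn ℝ univ R) (h0 : (0 : Vec n) ∈ subdiff R 0)
    {c : ℝ} (hc : 0 < c) (w : Vec n) : ∃ x, ∃ g ∈ subdiff R x, x - w + c • g = 0 := by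
  obtain ⟨x, hx⟩ := exists_forall_prox_le hR h0 hc.le w
  refine ⟨x, -(c⁻¹ • (x - w)), fun z => ?_, ?_⟩
  · have h := inner_add_mul_nonneg_of_forall_prox_le hR hc.le hx z
    rw [inner_neg_left, inner_smul_left]
    have : c⁻¹ * (inner ℝ (x - w) (z - x) + c * (R z - R x))
        = c⁻¹ * inner ℝ (x - w) (z - x) + (R z - R x) := by
      field_simp
    have h2 := mul_nonneg (inv_nonneg.2 hc.le) h
    rw [this] at h2
    simp only [map_inv₀, conj_trivial]
    linarith
  · rw [smul_neg, smul_smul, mul_inv_cancel₀ hc.ne', one_smul, add_neg_cancel]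

/-- Monotonicity against the subgradient `0` at `0` gives `⟨g, x⟩ ≥ 0`, so the cross term in `‖x + c
g‖²` is nonnegative. -/
theorem norm_le_of_prox (h0 : (0 : Vec n) ∈ subdiff R 0) {c : ℝ} (hc : 0 ≤ c) {w x g : Vec n}
    (hg : g ∈ subdiff R x) (h : x - w + c • g = 0) : ‖x‖ ≤ ‖w‖ := by
  have h1 : w = x + c • g := by rw [← sub_eq_zero, ← neg_eq_zero, ← h]; abel
  have h2 := mul_nonneg hc (inner_nonneg_of_mem_subdiff h0 hg)
  have h3 : ‖x‖ ^ 2 ≤ ‖w‖ ^ 2 := by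
    rw [h1, norm_add_sq_real, inner_smul_right, real_inner_comm]
    nlinarith [sq_nonneg ‖c • g‖]
  exact le_of_sq_le_sq h3 (norm_nonneg _)

/-- Merges the two growth alternatives into one bound on each ball. -/
theorem norm_subdiff_le_of_growth {M : ℝ} (hM : 0 < M)
    (hgrowth : ∀ x : Vec n, (∀ z ∈ subdiff R x, ‖z‖ ≤ M * ‖x‖) ∨ (∀ z ∈ subdiff R x, ‖z‖ ≤ M))
    {B : ℝ} {x g : Vec n} (hx : ‖x‖ ≤ B) (hg : g ∈ subdiff R x) : ‖g‖ ≤ M * (1 + B) := by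
  have hB : 0 ≤ B := (norm_nonneg x).trans hx
  rcases hgrowth x with h | h
  · exact (h g hg).trans (by gcongr; linarith)
  · exact (h g hg).trans (by nlinarith)

/-- The subdifferential is nonempty, as a limit point of proximal gradients. -/
theorem subdiff_nonempty (hR : ConvexOn ℝ univ R) (h0 : (0 : Vec n) ∈ subdiff R 0)
    (hgrowth : ∃ M : ℝ, 0 < M ∧ ∀ x : Vec n,
      (∀ z ∈ subdiff R x, ‖z‖ ≤ M * ‖x‖) ∨ (∀ z ∈ subdiff R x, ‖z‖ ≤ M))
    (w : Vec n) : (subdiff R w).Nonempty := by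
  obtain ⟨M, hM, hgrowth⟩ := hgrowth
  choose x g hg hx using fun k : ℕ =>
    exists_prox_of_pos hR h0 (c := 1 / ((k : ℝ) + 1)) (by positivity) w
  -- The proximal points stay in the ball of radius `‖w‖`, where the growth condition bounds their
  -- subgradients uniformly in `k`.
  have hb : ∀ k, g k ∈ Metric.closedBall (0 : Vec n) (M * (1 + ‖w‖)) := fun k => by
    rw [mem_closedBall_zero_iff]
    exact norm_subdiff_le_of_growth hM hgrowth
      (norm_le_of_prox h0 (by positivity) (hg k) (hx k)) (hg k)
  obtain ⟨g₀, -, φ, hφ, hlim⟩ := (isCompact_closedBall _ _).tendsto_subseq hb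
  have hxlim : Tendsto (fun k => x (φ k)) atTop (𝓝 w) := by
    have h1 : Tendsto (fun k => w - (1 / ((φ k : ℝ) + 1)) • g (φ k)) atTop
        (𝓝 (w - (0 : ℝ) • g₀)) := by
      refine tendsto_const_nhds.sub (Tendsto.smul ?_ hlim)
      exact tendsto_one_div_add_atTop_nhds_zero_nat.comp hφ.tendsto_atTop
    rw [zero_smul, sub_zero] at h1
    refine h1.congr fun k => ?_
    rw [eq_comm, ← sub_eq_zero, ← hx (φ k)]
    abel
  refine ⟨g₀, fun z => ?_⟩
  have hRc := hR.continuous_of_univ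
  exact le_of_tendsto (((hRc.tendsto w).comp hxlim).add
    (hlim.inner (tendsto_const_nhds.sub hxlim))) (Eventually.of_forall fun k => hg (φ k) z)

/-- The proximal inclusion has exactly one solution. -/
theorem existsUnique_prox (hR : ConvexOn ℝ univ R) (h0 : (0 : Vec n) ∈ subdiff R 0)
    (hne : ∀ w, (subdiff R w).Nonempty) {c : ℝ} (hc : 0 ≤ c) (w : Vec n) :
    ∃! x, ∃ g ∈ subdiff R x, x - w + c • g = 0 := by
  refine existsUnique_of_exists_of_unique ?_ ?_
  · rcases hc.eq_or_lt with rfl | hc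
    · obtain ⟨g, hg⟩ := hne w
      exact ⟨w, g, hg, by simp⟩
    · exact exists_prox_of_pos hR h0 hc w
  · rintro x y ⟨g, hg, hx⟩ ⟨g', hg', hy⟩
    have h1 : x - y = -(c • (g - g')) := by
      rw [← sub_eq_zero, ← sub_eq_zero.2 (hx.trans hy.symm), smul_sub]
      abel
    have h2 : ‖x - y‖ ^ 2 ≤ 0 := by
      rw [← real_inner_self_eq_norm_sq]
      nth_rw 1 [h1]
      rw [inner_neg_left, inner_smul_left]
      have := mul_nonneg hc (inner_sub_sub_nonneg_of_mem_subdiff hg hg')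
      simpa using this
    rw [← sub_eq_zero, ← norm_eq_zero]
    exact pow_eq_zero_iff two_ne_zero |>.1 (le_antisymm h2 (sq_nonneg _))

end Convex

/-! ### The gradient of the data term -/

section DataGrad

variable {m n : ℕ}

theorem norm_toEuclideanLin_le (A : Mat m n) (x : Vec n) :
    ‖A.toEuclideanLin x‖ ≤ ‖A‖ * ‖x‖ := by
  exact Matrix.l2_opNorm_mulVec A x

theorem norm_transpose_mat (A : Mat m n) : ‖A.transpose‖ = ‖A‖ := by
  rw [← Matrix.conjTranspose_eq_transpose_of_trivial, Matrix.l2_opNorm_conjTranspose]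

theorem norm_dataGrad_le (A : Mat m n) (b : Vec m) (x : Vec n) :
    ‖dataGrad A b x‖ ≤ ‖A‖ * (‖A‖ * ‖x‖ + ‖b‖) := by
  refine (norm_toEuclideanLin_le _ _).trans ?_
  rw [norm_transpose_mat]
  gcongr
  exact (norm_sub_le _ _).trans (by gcongr; exact norm_toEuclideanLin_le _ _)

theorem inner_transpose_toEuclideanLin (A : Mat m n) (v : Vec m) (x : Vec n) :
    inner ℝ (A.transpose.toEuclideanLin v) x = inner ℝ v (A.toEuclideanLin x) := by
  rw [← Matrix.conjTranspose_eq_transpose_of_trivial, Matrix.toEuclideanLin_conjTranspose_eq_adjoint,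
    LinearMap.adjoint_inner_left]

/-- The difference of the gradients is `Aᵀ A (x - y)`, so the pairing equals `‖A (x - y)‖²`. -/
theorem inner_dataGrad_sub_nonneg (A : Mat m n) (b : Vec m) (x y : Vec n) :
    0 ≤ inner ℝ (dataGrad A b x - dataGrad A b y) (x - y) := by
  have : dataGrad A b x - dataGrad A b y
      = A.transpose.toEuclideanLin (A.toEuclideanLin (x - y)) := by
    simp only [dataGrad, ← map_sub]
    congr 1
    simp
  rw [this, inner_transpose_toEuclideanLin]
  exact real_inner_self_nonneg

theorem Continuous.toEuclideanLin {X : Type*} [TopologicalSpace X] {f : X → Mat m n}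
    {g : X → Vec n} (hf : Continuous f) (hg : Continuous g) :
    Continuous fun x => (f x).toEuclideanLin (g x) :=
  (PiLp.continuous_toLp 2 _).comp (hf.matrix_mulVec ((PiLp.continuous_ofLp 2 _).comp hg))

theorem Continuous.dataGrad {X : Type*} [TopologicalSpace X] {f : X → Mat m n} {g : X → Vec n}
    (hf : Continuous f) (b : Vec m) (hg : Continuous g) :
    Continuous fun x => dataGrad (f x) b (g x) :=
  hf.matrix_transpose.toEuclideanLin ((hf.toEuclideanLin hg).sub continuous_const)

end DataGrad

theorem ae_restrict_Icc_iff_Ioc {a b : ℝ} {P : ℝ → Prop} :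
    (∀ᵐ t ∂(volume.restrict (Icc a b)), P t) ↔ ∀ᵐ t, t ∈ Ioc a b → P t := by
  rw [← Measure.restrict_congr_set Ioc_ae_eq_Icc, ae_restrict_iff' measurableSet_Ioc]

/-! ### Step functions and averages over cells -/

section CellMean

variable {E : Type*} [NormedAddCommGroup E] {h : ℝ}

/-- The function with value `a k` on `[k h, (k + 1) h)`. -/
noncomputable def stepFun {X : Type*} (h : ℝ) (a : ℕ → X) (t : ℝ) : X := a ⌊t / h⌋₊

theorem stepFun_eq {X : Type*} (hh : 0 < h) (a : ℕ → X) {k : ℕ} {t : ℝ}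
    (ht : t ∈ Ico (k * h) ((k + 1) * h)) : stepFun h a t = a k := by
  have : ⌊t / h⌋₊ = k := by
    have hk : (0 : ℝ) ≤ t / h := div_nonneg (le_trans (by positivity) ht.1) hh.le
    rw [Nat.floor_eq_iff hk]
    exact ⟨(le_div_iff₀ hh).2 ht.1, (div_lt_iff₀ hh).2 ht.2⟩
  rw [stepFun, this]

theorem stronglyMeasurable_stepFun {X : Type*} [TopologicalSpace X] (h : ℝ) (a : ℕ → X) :
    StronglyMeasurable (stepFun h a) :=
  (StronglyMeasurable.of_discrete (f := a)).comp_measurable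
    (Nat.measurable_floor.comp (measurable_id.div_const h))

theorem ae_stepFun_eq {X : Type*} (hh : 0 < h) (a : ℕ → X) (k : ℕ) :
    ∀ᵐ t, t ∈ uIoc (k * h) ((k + 1) * h) → a k = stepFun h a t := by
  filter_upwards [Measure.ae_ne volume (((k : ℝ) + 1) * h)] with t ht htm
  rw [uIoc_of_le (by nlinarith)] at htm
  exact (stepFun_eq hh a ⟨htm.1.le, lt_of_le_of_ne htm.2 ht⟩).symm

theorem intervalIntegrable_stepFun_cell (hh : 0 < h) (a : ℕ → E) (k : ℕ) :
    IntervalIntegrable (stepFun h a) volume (k * h) ((k + 1) * h) :=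
  (intervalIntegrable_const (c := a k)).congr_ae
    ((ae_restrict_iff' measurableSet_uIoc).2 (ae_stepFun_eq hh a k))

theorem intervalIntegrable_stepFun (hh : 0 < h) (a : ℕ → E) {i j : ℕ} (hij : i ≤ j) :
    IntervalIntegrable (stepFun h a) volume (i * h) (j * h) :=
  IntervalIntegrable.trans_iterate_Ico (a := fun k : ℕ => (k : ℝ) * h) hij fun k _ => by
    simpa using intervalIntegrable_stepFun_cell hh a k

theorem integral_stepFun [NormedSpace ℝ E] [CompleteSpace E] (hh : 0 < h) (a : ℕ → E) {i j : ℕ}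
    (hij : i ≤ j) :
    ∫ t in (i * h)..(j * h), stepFun h a t = ∑ k ∈ Finset.Ico i j, h • a k := by
  rw [← intervalIntegral.sum_integral_adjacent_intervals_Ico (a := fun k : ℕ => (k : ℝ) * h) hij
    fun k _ => by simpa using intervalIntegrable_stepFun_cell hh a k]
  refine Finset.sum_congr rfl fun k _ => ?_
  push_cast
  rw [← intervalIntegral.integral_congr_ae (ae_stepFun_eq hh a k),
    intervalIntegral.integral_const]
  congr 1
  ring

variable [NormedSpace ℝ E]

/-- The mean value of `V` over `[k h, (k + 1) h]`. -/
noncomputable def cellMean (h : ℝ) (V : ℝ → E) (k : ℕ) : E :=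
  h⁻¹ • ∫ s in (k * h)..((k + 1) * h), V s

omit [NormedSpace ℝ E] in
theorem IntervalIntegrable.cell {V : ℝ → E} {N : ℕ} (hh : 0 < h)
    (hV : IntervalIntegrable V volume 0 (N * h)) {k : ℕ} (hk : k < N) :
    IntervalIntegrable V volume (k * h) ((k + 1) * h) := by
  have h1 : ((k : ℝ) + 1) ≤ N := by exact_mod_cast hk
  have h2 : (0 : ℝ) ≤ k := by positivity
  refine hV.mono_set ?_
  rw [uIcc_of_le (by nlinarith), uIcc_of_le (by nlinarith)]
  exact Icc_subset_Icc (by positivity) (by gcongr)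

/-- Taking `v = 0` bounds the means of a bounded function; taking `v` to be a value of a uniformly
continuous function controls its distance to the mean. -/
theorem norm_cellMean_sub_le [CompleteSpace E] (hh : 0 < h) {V : ℝ → E} {k : ℕ} {v : E} {D : ℝ}
    (hV : IntervalIntegrable V volume (k * h) ((k + 1) * h))
    (hD : ∀ᵐ s, s ∈ Ioc (k * h) ((k + 1) * h) → ‖V s - v‖ ≤ D) : ‖cellMean h V k - v‖ ≤ D := by
  have hlen : ((k : ℝ) + 1) * h - k * h = h := by ring
  have h1 : cellMean h V k - v = h⁻¹ • ∫ s in (k * h)..((k + 1) * h), (V s - v) := by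
    rw [intervalIntegral.integral_sub hV intervalIntegrable_const,
      intervalIntegral.integral_const, hlen, smul_sub, smul_smul, inv_mul_cancel₀ hh.ne', one_smul]
    rfl
  have h2 := intervalIntegral.norm_integral_le_of_norm_le_const_ae (f := fun s => V s - v) (C := D)
    (a := k * h) (b := (k + 1) * h) (by rwa [uIoc_of_le (by nlinarith)])
  rw [hlen, abs_of_pos hh] at h2
  rw [h1, norm_smul, norm_inv, Real.norm_eq_abs, abs_of_pos hh, inv_mul_le_iff₀ hh]
  linarith

theorem cellMean_nonneg (hh : 0 < h) {V : ℝ → ℝ} {k : ℕ}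
    (hV : ∀ᵐ s, s ∈ Ioc (k * h) ((k + 1) * h) → 0 ≤ V s) : 0 ≤ cellMean h V k := by
  refine mul_nonneg (inv_nonneg.2 hh.le) ?_
  rw [intervalIntegral.integral_of_le (by nlinarith)]
  exact setIntegral_nonneg_of_ae_restrict ((ae_restrict_iff' measurableSet_Ioc).2 hV)

theorem cellMean_sub (hh : 0 < h) {V W : ℝ → E} {N : ℕ}
    (hV : IntervalIntegrable V volume 0 (N * h)) (hW : IntervalIntegrable W volume 0 (N * h))
    {k : ℕ} (hk : k < N) :
    cellMean h (fun t => V t - W t) k = cellMean h V k - cellMean h W k := by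
  rw [cellMean, intervalIntegral.integral_sub (hV.cell hh hk) (hW.cell hh hk), smul_sub]
  rfl

theorem floor_div_lt (hh : 0 < h) {N : ℕ} {t : ℝ} (h0 : 0 ≤ t) (ht : t < N * h) :
    ⌊t / h⌋₊ < N := by
  rw [Nat.floor_lt (div_nonneg h0 hh.le)]
  exact (div_lt_iff₀ hh).2 ht

theorem mem_cell_floor (hh : 0 < h) {t : ℝ} (h0 : 0 ≤ t) :
    t ∈ Ico ((⌊t / h⌋₊ : ℝ) * h) ((⌊t / h⌋₊ + 1) * h) :=
  ⟨(le_div_iff₀ hh).1 (Nat.floor_le (div_nonneg h0 hh.le)),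
    (div_lt_iff₀ hh).1 (Nat.lt_floor_add_one _)⟩

/-- The triangle inequality for the integral on each cell, summed over the cells: averaging is an
`L¹` contraction. -/
theorem integral_norm_stepFun_cellMean_le (hh : 0 < h) {V : ℝ → E} {N : ℕ}
    (hV : IntervalIntegrable V volume 0 (N * h)) :
    ∫ t in 0..(N * h), ‖stepFun h (cellMean h V) t‖ ≤ ∫ t in 0..(N * h), ‖V t‖ := by
  have h1 := integral_stepFun hh (fun k => ‖cellMean h V k‖) (Nat.zero_le N)
  have h2 := intervalIntegral.sum_integral_adjacent_intervals_Ico (f := fun t => ‖V t‖)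
    (μ := volume) (a := fun k : ℕ => (k : ℝ) * h) (Nat.zero_le N)
    fun k hk => by simpa using (hV.cell hh hk.2).norm
  simp only [Nat.cast_zero, zero_mul] at h1 h2
  change ∫ t in 0..(N * h), stepFun h (fun k => ‖cellMean h V k‖) t ≤ _
  rw [h1, ← h2]
  refine Finset.sum_le_sum fun k _ => ?_
  rw [cellMean, norm_smul, norm_inv, Real.norm_eq_abs, abs_of_pos hh, smul_eq_mul,
    mul_inv_cancel_left₀ hh.ne']
  push_cast
  exact intervalIntegral.norm_integral_le_integral_norm (by nlinarith)

/-- Transfers a cellwise statement to almost every time. The point `T` is discarded because its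
floor index is `N`, which is not a cell. -/
theorem ae_uIoc_zero_floor (hh : 0 < h) {N : ℕ} {T : ℝ} (hT : N * h = T) {P : ℕ → ℝ → Prop}
    (hP : ∀ k < N, ∀ t ∈ Ico (k * h) ((k + 1) * h), P k t) :
    ∀ᵐ t, t ∈ Ioc 0 T → P ⌊t / h⌋₊ t := by
  filter_upwards [Measure.ae_ne volume T] with t ht htm
  exact hP _ (floor_div_lt hh htm.1.le (hT ▸ lt_of_le_of_ne htm.2 ht)) _
    (mem_cell_floor hh htm.1.le)

variable [CompleteSpace E] {ι : Type*} {l : Filter ι} {N : ι → ℕ} {T : ℝ}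

/-- Density: up to a small `L¹` error, `V` is a continuous compactly supported `g`. The contraction
property handles the average of `V - g`, and uniform continuity handles `g`. -/
theorem tendsto_integral_norm_stepFun_cellMean_sub (hT : 0 < T) (hN : ∀ i, 1 ≤ N i)
    (hNl : Tendsto N l atTop) {V : ℝ → E} (hV : IntervalIntegrable V volume 0 T) :
    Tendsto (fun i => ∫ t in 0..T, ‖stepFun (T / N i) (cellMean (T / N i) V) t - V t‖) l (𝓝 0) := by
  have hN' : ∀ i, (0 : ℝ) < N i := fun i => by exact_mod_cast hN i
  have hh : ∀ i, 0 < T / N i := fun i => div_pos hT (hN' i)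
  have hNh : ∀ i, N i * (T / N i) = T := fun i => mul_div_cancel₀ _ (hN' i).ne'
  have hhl : Tendsto (fun i => T / (N i : ℝ)) l (𝓝 0) :=
    (tendsto_natCast_atTop_atTop.comp hNl).const_div_atTop T
  rw [Metric.tendsto_nhds]
  intro ε hε
  have hVi : Integrable ((Ioc 0 T).indicator V) :=
    (integrable_indicator_iff measurableSet_Ioc).2
      ((intervalIntegrable_iff_integrableOn_Ioc_of_le hT.le).1 hV)
  obtain ⟨g, hgc, hgV, hg, hgi⟩ :=
    hVi.exists_hasCompactSupport_integral_sub_le (ε := ε / 4) (by positivity)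
  have hgV' : ∫ t in 0..T, ‖V t - g t‖ ≤ ε / 4 := by
    rw [intervalIntegral.integral_of_le hT.le]
    refine le_trans (le_of_eq ?_) ((setIntegral_le_integral (s := Ioc 0 T) (hVi.sub hgi).norm
      (Eventually.of_forall fun t => norm_nonneg _)).trans hgV)
    refine setIntegral_congr_fun measurableSet_Ioc fun t ht => ?_
    simp [indicator_of_mem ht]
  have hgint : IntervalIntegrable g volume 0 T := hg.intervalIntegrable _ _
  -- With oscillation at most `ε / (4 T)` on a cell, the three contributions (averaged `V - g`,
  -- oscillation of `g`, and `V - g` itself) are at most `ε / 4` each.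
  obtain ⟨δ, hδ, hgδ⟩ := Metric.uniformContinuous_iff.1
    (hgc.uniformContinuous_of_continuous hg) (ε / (4 * T)) (by positivity)
  filter_upwards [hhl.eventually (gt_mem_nhds hδ)] with i hi
  have hstep : ∀ W : ℝ → E,
      IntervalIntegrable (stepFun (T / N i) (cellMean (T / N i) W)) volume 0 T := fun W => by
    simpa [hNh] using intervalIntegrable_stepFun (hh i) (cellMean (T / N i) W) (Nat.zero_le (N i))
  have h1 : ∫ t in 0..T, ‖stepFun (T / N i) (cellMean (T / N i) fun t => V t - g t) t‖ ≤ ε / 4 := by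
    have := integral_norm_stepFun_cellMean_le (hh i) (V := fun t => V t - g t) (N := N i)
      (by rw [hNh]; exact hV.sub hgint)
    rw [hNh] at this
    exact this.trans hgV'
  have h2 : ∀ᵐ t, t ∈ Ioc 0 T → ‖stepFun (T / N i) (cellMean (T / N i) V) t - V t‖
      ≤ ‖stepFun (T / N i) (cellMean (T / N i) fun t => V t - g t) t‖ + ε / (4 * T)
        + ‖V t - g t‖ := by
    refine ae_uIoc_zero_floor (P := fun k t => ‖cellMean (T / N i) V k - V t‖
      ≤ ‖cellMean (T / N i) (fun t => V t - g t) k‖ + ε / (4 * T) + ‖V t - g t‖)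
      (hh i) (hNh i) fun k hk t ht => ?_
    rw [cellMean_sub (hh i) (by rwa [hNh]) (by rwa [hNh]) hk]
    have h3 : ‖cellMean (T / N i) g k - g t‖ ≤ ε / (4 * T) := by
      refine norm_cellMean_sub_le (hh i) (hg.intervalIntegrable _ _)
        (Eventually.of_forall fun s hs => ?_)
      rw [← dist_eq_norm]
      refine (hgδ ?_).le
      rw [Real.dist_eq, abs_lt]
      constructor <;> linarith [hs.1, hs.2, ht.1, ht.2]
    calc ‖cellMean (T / N i) V k - V t‖
        = ‖(cellMean (T / N i) V k - cellMean (T / N i) g k)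
          + (cellMean (T / N i) g k - g t) - (V t - g t)‖ := by congr 1; abel
      _ ≤ _ := (norm_sub_le _ _).trans (by gcongr; exact (norm_add_le _ _).trans (by gcongr))
  have h4 := intervalIntegral.integral_mono_ae_restrict hT.le ((hstep V).sub hV).norm
    (((hstep _).norm.add (intervalIntegrable_const (c := ε / (4 * T)))).add (hV.sub hgint).norm)
    (ae_restrict_Icc_iff_Ioc.2 h2)
  rw [intervalIntegral.integral_add ((hstep _).norm.add intervalIntegrable_const)
    (hV.sub hgint).norm, intervalIntegral.integral_add (hstep _).norm intervalIntegrable_const,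
    intervalIntegral.integral_const] at h4
  have h5 : (T - 0) • (ε / (4 * T)) = ε / 4 := by
    rw [smul_eq_mul]; field_simp; ring
  rw [Real.dist_eq, sub_zero, abs_of_nonneg
    (intervalIntegral.integral_nonneg hT.le fun t _ => norm_nonneg _)]
  linarith

/-- If `Vᵢ → V` in `L¹`, then the projections of `Vᵢ` onto finer and finer step functions
converge to `V` in `L¹`. -/
theorem tendsto_integral_norm_stepFun_cellMean_sub_of_tendsto (hT : 0 < T) (hN : ∀ i, 1 ≤ N i)
    (hNl : Tendsto N l atTop) {V : ℝ → E} (hV : IntervalIntegrable V volume 0 T)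
    {W : ι → ℝ → E} (hW : ∀ i, IntervalIntegrable (W i) volume 0 T)
    (hWV : Tendsto (fun i => ∫ t in 0..T, ‖W i t - V t‖) l (𝓝 0)) :
    Tendsto (fun i => ∫ t in 0..T, ‖stepFun (T / N i) (cellMean (T / N i) (W i)) t - V t‖)
      l (𝓝 0) := by
  have hN' : ∀ i, (0 : ℝ) < N i := fun i => by exact_mod_cast hN i
  have hh : ∀ i, 0 < T / N i := fun i => div_pos hT (hN' i)
  have hNh : ∀ i, N i * (T / N i) = T := fun i => mul_div_cancel₀ _ (hN' i).ne'
  -- Split the error into the average of `W i - V`, controlled by contraction, and the error for the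
  -- fixed function `V`.
  have h1 := hWV.add (tendsto_integral_norm_stepFun_cellMean_sub hT hN hNl hV)
  rw [add_zero] at h1
  refine squeeze_zero (fun i => intervalIntegral.integral_nonneg hT.le fun t _ => norm_nonneg _)
    (fun i => ?_) h1
  have hstep : ∀ W : ℝ → E,
      IntervalIntegrable (stepFun (T / N i) (cellMean (T / N i) W)) volume 0 T := fun W => by
    simpa [hNh] using intervalIntegrable_stepFun (hh i) (cellMean (T / N i) W) (Nat.zero_le (N i))
  have h2 := integral_norm_stepFun_cellMean_le (hh i) (V := fun t => W i t - V t) (N := N i)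
    (by rw [hNh]; exact (hW i).sub hV)
  rw [hNh] at h2
  refine le_trans ?_ (add_le_add_left h2 _)
  rw [← intervalIntegral.integral_add (hstep _).norm ((hstep V).sub hV).norm]
  refine intervalIntegral.integral_mono_ae_restrict hT.le ((hstep _).sub hV).norm
    ((hstep _).norm.add ((hstep V).sub hV).norm) ?_
  refine ae_restrict_Icc_iff_Ioc.2 (ae_uIoc_zero_floor
    (P := fun k t => ‖cellMean (T / N i) (W i) k - V t‖
      ≤ ‖cellMean (T / N i) (fun t => W i t - V t) k‖ + ‖cellMean (T / N i) V k - V t‖)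
    (hh i) (hNh i) fun k hk t ht => ?_)
  rw [cellMean_sub (hh i) (by rw [hNh]; exact hW i) (by rwa [hNh]) hk]
  exact (congrArg norm (by abel)).trans_le (norm_add_le _ _)

end CellMean

/-! ### Continuous functions of `L¹`-convergent bounded functions -/

section ContinuousImage

variable {X : Type*} [NormedAddCommGroup X]

/-- Nearby points are handled by uniform continuity; points at distance at least `δ` by boundedness,
because then `2 |D| ≤ (2 |D| / δ) ‖a - b‖`. This affine bound takes the place of a Lipschitz
estimate when integrating. -/
theorem IsCompact.exists_dist_le_add_mul {K : Set X} (hK : IsCompact K) {F : X → ℝ}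
    (hF : Continuous F) {ε : ℝ} (hε : 0 < ε) :
    ∃ C, 0 ≤ C ∧ ∀ a ∈ K, ∀ b ∈ K, |F a - F b| ≤ ε + C * ‖a - b‖ := by
  obtain ⟨δ, hδ, h⟩ := Metric.uniformContinuousOn_iff.1
    (hK.uniformContinuousOn_of_continuous hF.continuousOn) ε hε
  obtain ⟨D, hD⟩ := hK.exists_bound_of_continuousOn hF.continuousOn
  refine ⟨2 * |D| / δ, by positivity, fun a ha b hb => ?_⟩
  by_cases hab : dist a b < δ
  · have := (h a ha b hb hab).le
    rw [Real.dist_eq] at this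
    have h2 : 0 ≤ 2 * |D| / δ * ‖a - b‖ := by positivity
    linarith
  · rw [dist_eq_norm, not_lt] at hab
    have h1 : |F a - F b| ≤ 2 * |D| := by
      have h3 := (hD a ha).trans (le_abs_self D)
      have h4 := (hD b hb).trans (le_abs_self D)
      exact (norm_sub_le (F a) (F b)).trans (by linarith)
    have h2 : 2 * |D| ≤ 2 * |D| / δ * ‖a - b‖ := by
      rw [div_mul_eq_mul_div, le_div_iff₀ hδ]
      gcongr
    linarith

variable {Ω : Type*} [MeasurableSpace Ω] {μ : Measure Ω} [IsFiniteMeasure μ]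

theorem integrable_comp_of_mem_compact {K : Set X} (hK : IsCompact K) {F : X → ℝ}
    (hF : Continuous F) {w : Ω → X} (hw : AEStronglyMeasurable w μ) (hwK : ∀ᵐ t ∂μ, w t ∈ K) :
    Integrable (fun t => F (w t)) μ := by
  obtain ⟨D, hD⟩ := hK.exists_bound_of_continuousOn hF.continuousOn
  exact Integrable.of_bound (hF.comp_aestronglyMeasurable hw) D (hwK.mono fun t ht => hD _ ht)

theorem integrable_of_mem_compact {K : Set X} (hK : IsCompact K) {w : Ω → X}
    (hw : AEStronglyMeasurable w μ) (hwK : ∀ᵐ t ∂μ, w t ∈ K) : Integrable w μ := by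
  obtain ⟨D, hD⟩ := hK.exists_bound_of_continuousOn continuous_id.continuousOn
  exact Integrable.of_bound hw D (hwK.mono fun t ht => hD _ ht)

/-- Continuous functions preserve `L¹` convergence of functions with values in a compact set. -/
theorem tendsto_integral_abs_comp_sub {ι : Type*} {l : Filter ι} {K : Set X} (hK : IsCompact K)
    {F : X → ℝ} (hF : Continuous F) {w : ι → Ω → X} {v : Ω → X}
    (hw : ∀ i, AEStronglyMeasurable (w i) μ) (hv : AEStronglyMeasurable v μ)
    (hwK : ∀ i, ∀ᵐ t ∂μ, w i t ∈ K) (hvK : ∀ᵐ t ∂μ, v t ∈ K)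
    (hwv : Tendsto (fun i => ∫ t, ‖w i t - v t‖ ∂μ) l (𝓝 0)) :
    Tendsto (fun i => ∫ t, |F (w i t) - F (v t)| ∂μ) l (𝓝 0) := by
  rw [Metric.tendsto_nhds]
  intro ε hε
  set m := μ.real univ with hm
  have hm0 : 0 ≤ m := measureReal_nonneg
  obtain ⟨C, hC0, hC⟩ := hK.exists_dist_le_add_mul hF (ε := ε / (2 * (m + 1))) (by positivity)
  have h1 : Tendsto (fun i => C * ∫ t, ‖w i t - v t‖ ∂μ) l (𝓝 0) := by
    simpa using hwv.const_mul C
  filter_upwards [h1.eventually (gt_mem_nhds (half_pos hε))] with i hi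
  rw [Real.dist_eq, sub_zero, abs_of_nonneg (integral_nonneg fun t => abs_nonneg _)]
  have hint : Integrable (fun t => ‖w i t - v t‖) μ :=
    ((integrable_of_mem_compact hK (hw i) (hwK i)).sub (integrable_of_mem_compact hK hv hvK)).norm
  have h2 : ∫ t, |F (w i t) - F (v t)| ∂μ
      ≤ ∫ t, (ε / (2 * (m + 1)) + C * ‖w i t - v t‖) ∂μ := by
    refine integral_mono_ae ((integrable_comp_of_mem_compact hK hF (hw i) (hwK i)).sub
      (integrable_comp_of_mem_compact hK hF hv hvK)).abs
      ((integrable_const _).add (hint.const_mul C)) ?_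
    filter_upwards [hwK i, hvK] with t h1 h2 using hC _ h1 _ h2
  rw [integral_add (integrable_const _) (hint.const_mul C), integral_const, integral_const_mul,
    ← hm, smul_eq_mul] at h2
  have h3 : m * (ε / (2 * (m + 1))) < ε / 2 := by
    rw [mul_div_assoc', div_lt_div_iff₀ (by positivity) (by positivity)]
    nlinarith
  linarith

end ContinuousImage

/-! ### From discrete to integrated inequalities -/

section StepSums

variable {h T : ℝ} {N : ℕ}

theorem floor_div_le (hh : 0 < h) (hT : N * h = T) {t : ℝ} (ht : t ≤ T) : ⌊t / h⌋₊ ≤ N := by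
  rw [← Nat.floor_natCast (R := ℝ) N]
  exact Nat.floor_le_floor ((div_le_iff₀ hh).2 (ht.trans hT.ge))

/-- A discrete differential inequality, written in terms of step functions. -/
theorem stepFun_sub_le_integral (hh : 0 < h) (hT : N * h = T) {S φ : ℕ → ℝ} {D Φ : ℝ}
    (hD : 0 ≤ D) (hS : ∀ k < N, S (k + 1) - S k ≤ h * φ k + D * h ^ 2)
    (hΦ : 0 ≤ Φ) (hφ : ∀ k < N, |φ k| ≤ Φ) {s t : ℝ} (hs : 0 ≤ s) (hst : s ≤ t) (ht : t ≤ T) :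
    stepFun h S t - stepFun h S s ≤ (∫ τ in s..t, stepFun h φ τ) + (2 * Φ + D * T) * h := by
  -- Telescoping runs between the left endpoints of the cells of `s` and `t`. Each mismatch between
  -- an endpoint and the actual time costs at most `Φ h`, and at most `N` errors `D h²` add up to `D
  -- T h`.
  set i := ⌊s / h⌋₊ with hi
  set j := ⌊t / h⌋₊ with hj
  have hij : i ≤ j := Nat.floor_le_floor (by gcongr)
  have hjN : j ≤ N := floor_div_le hh hT ht
  have hsi := mem_cell_floor hh hs
  have htj := mem_cell_floor hh (hs.trans hst)
  rw [← hi] at hsi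
  rw [← hj] at htj
  have h1 : S j - S i ≤ ∑ k ∈ Finset.Ico i j, (h * φ k + D * h ^ 2) := by
    rw [← Finset.sum_Ico_sub S hij]
    exact Finset.sum_le_sum fun k hk => hS k ((Finset.mem_Ico.1 hk).2.trans_le hjN)
  have h2 : ∑ k ∈ Finset.Ico i j, (h * φ k + D * h ^ 2)
      ≤ (∫ τ in (i * h)..(j * h), stepFun h φ τ) + D * T * h := by
    rw [integral_stepFun hh φ hij, Finset.sum_add_distrib]
    simp only [smul_eq_mul, Finset.sum_const, Nat.card_Ico, nsmul_eq_mul]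
    have : ((j - i : ℕ) : ℝ) ≤ N := by exact_mod_cast (Nat.sub_le j i).trans hjN
    have h3 : ((j - i : ℕ) : ℝ) * (D * h ^ 2) ≤ N * (D * h ^ 2) := by gcongr
    have h4 : N * (D * h ^ 2) = D * T * h := by rw [← hT]; ring
    linarith
  have hTint : IntervalIntegrable (stepFun h φ) volume 0 T := by
    have := intervalIntegrable_stepFun hh φ (Nat.zero_le N)
    rwa [hT, Nat.cast_zero, zero_mul] at this
  have hT0 : 0 ≤ T := hs.trans (hst.trans ht)
  have hint : ∀ a ∈ Icc 0 T, ∀ c ∈ Icc 0 T, IntervalIntegrable (stepFun h φ) volume a c := by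
    intro a ha c hc
    refine hTint.mono_set ?_
    rw [uIcc_of_le hT0]
    exact uIcc_subset_Icc ha hc
  have hb : ∀ᵐ τ, τ ∈ Ioc 0 T → |stepFun h φ τ| ≤ Φ :=
    ae_uIoc_zero_floor (P := fun k _ => |φ k| ≤ Φ) hh hT fun k hk _ _ => hφ k hk
  have hsmall : ∀ a ∈ Icc 0 T, ∀ c ∈ Icc 0 T, a ≤ c → c - a ≤ h →
      |∫ τ in a..c, stepFun h φ τ| ≤ Φ * h := by
    intro a ha c hc hac hle
    have := intervalIntegral.norm_integral_le_of_norm_le_const_ae (f := stepFun h φ) (C := Φ)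
      (a := a) (b := c) (by
        filter_upwards [hb] with τ hτ hm
        rw [uIoc_of_le hac] at hm
        exact hτ ⟨ha.1.trans_lt hm.1, hm.2.trans hc.2⟩)
    rw [abs_of_nonneg (sub_nonneg.2 hac)] at this
    exact this.trans (by gcongr)
  have hmem : ∀ {k : ℕ}, k ≤ N → (k : ℝ) * h ∈ Icc 0 T := fun {k} hk =>
    ⟨by positivity, by rw [← hT]; gcongr⟩
  have hs' : s ∈ Icc 0 T := ⟨hs, hst.trans ht⟩
  have ht' : t ∈ Icc 0 T := ⟨hs.trans hst, ht⟩
  have hi' := hmem (hij.trans hjN)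
  have hj' := hmem hjN
  have h3 := intervalIntegral.integral_add_adjacent_intervals (hint _ hi' _ hs') (hint _ hs' _ ht')
  have h4 := intervalIntegral.integral_add_adjacent_intervals (hint _ hi' _ hj') (hint _ hj' _ ht')
  have h5 := (abs_le.1 (hsmall _ hi' _ hs' hsi.1 (by linarith [hsi.2]))).2
  have h6 := (abs_le.1 (hsmall _ hj' _ ht' htj.1 (by linarith [htj.2]))).1
  change S j - S i ≤ _
  linarith

end StepSums

/-! ### Uniform estimates for network states -/

section DiscreteState

variable {m n : ℕ} {R : Vec n → ℝ} {b : Vec m} {x₀ : Vec n} {h T C : ℝ} {N : ℕ}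
  {A : ℕ → Mat m n} {α lam : ℕ → ℝ} {X : ℕ → Vec n}

/-- The network recursion for sequences indexed by `ℕ`, for the first `N` steps. -/
def IsDiscreteState (R : Vec n → ℝ) (h : ℝ) (b : Vec m) (x₀ : Vec n) (N : ℕ)
    (A : ℕ → Mat m n) (α lam : ℕ → ℝ) (X : ℕ → Vec n) : Prop :=
  X 0 = x₀ ∧ ∀ k < N, ∃ g ∈ subdiff R (X (k + 1)),
    X (k + 1) - X k + (h * α k) • dataGrad (A k) b (X k) + (h * α k * lam k) • g = 0

/-- Bounds on the first `N` network parameters. -/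
def ParamBound (C : ℝ) (N : ℕ) (A : ℕ → Mat m n) (α lam : ℕ → ℝ) : Prop :=
  ∀ k < N, ‖A k‖ ≤ C ∧ (0 ≤ α k ∧ α k ≤ C) ∧ (0 ≤ lam k ∧ lam k ≤ C)

/-- The right-hand side of the evolution variational inequality. -/
noncomputable def eviRate (R : Vec n → ℝ) (b : Vec m) (z : Vec n)
    (q : (Mat m n × ℝ × ℝ) × Vec n) : ℝ :=
  -(q.1.2.1 * inner ℝ (dataGrad q.1.1 b q.2) (q.2 - z)) + q.1.2.1 * q.1.2.2 * (R z - R q.2)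

theorem continuous_eviRate (hR : Continuous R) (b : Vec m) (z : Vec n) :
    Continuous (eviRate (m := m) R b z) := by
  have h1 : Continuous fun q : (Mat m n × ℝ × ℝ) × Vec n => dataGrad q.1.1 b q.2 :=
    (continuous_fst.comp continuous_fst).dataGrad b continuous_snd
  have h2 : Continuous fun q : (Mat m n × ℝ × ℝ) × Vec n => q.1.2.1 :=
    continuous_fst.comp (continuous_snd.comp continuous_fst)
  have h3 : Continuous fun q : (Mat m n × ℝ × ℝ) × Vec n => q.1.2.2 :=
    continuous_snd.comp (continuous_snd.comp continuous_fst)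
  have h4 : Continuous fun q : (Mat m n × ℝ × ℝ) × Vec n => q.2 - z :=
    continuous_snd.sub continuous_const
  have h5 : Continuous fun q : (Mat m n × ℝ × ℝ) × Vec n => R z - R q.2 :=
    continuous_const.sub (hR.comp continuous_snd)
  exact (h2.mul (h1.inner h4)).neg.add ((h2.mul h3).mul h5)

/-- Discrete Gronwall: the proximal step does not increase the norm, so only the explicit gradient
step contributes to growth, by the factor `1 + h C³` and the increment `h C² ‖b‖`. -/
theorem IsDiscreteState.norm_le (h0 : (0 : Vec n) ∈ subdiff R 0) (hh : 0 < h) (hT : N * h = T)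
    (hC : 0 ≤ C) (hp : ParamBound C N A α lam) (hX : IsDiscreteState R h b x₀ N A α lam X)
    {k : ℕ} (hk : k ≤ N) :
    ‖X k‖ ≤ (‖x₀‖ + T * (C * (C * ‖b‖))) * Real.exp (T * C ^ 3) := by
  have key : ∀ k ≤ N, ‖X k‖ ≤ (‖x₀‖ + k * (h * (C * (C * ‖b‖)))) * Real.exp (k * (h * C ^ 3)) := by
    intro k
    induction k with
    | zero => intro _; simp [hX.1]
    | succ k ih =>
      intro hk
      have ih := ih (by omega)
      obtain ⟨hA, ⟨hα0, hα⟩, hl0, hl⟩ := hp k hk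
      obtain ⟨g, hg, hx⟩ := hX.2 k hk
      have h1 : ‖X (k + 1)‖ ≤ ‖X k - (h * α k) • dataGrad (A k) b (X k)‖ :=
        norm_le_of_prox h0 (c := h * α k * lam k) (by positivity) hg (by rw [← hx]; abel)
      have h2 : ‖dataGrad (A k) b (X k)‖ ≤ C * (C * ‖X k‖ + ‖b‖) :=
        (norm_dataGrad_le _ _ _).trans (by gcongr)
      have h3 : ‖X (k + 1)‖ ≤ ‖X k‖ + h * C * (C * (C * ‖X k‖ + ‖b‖)) := by
        refine h1.trans ((norm_sub_le _ _).trans ?_)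
        rw [norm_smul, Real.norm_eq_abs, abs_of_nonneg (by positivity)]
        gcongr
      set q := h * C ^ 3 with hq
      set r := h * (C * (C * ‖b‖)) with hr
      have hr0 : 0 ≤ r := by positivity
      have h4 : ‖X (k + 1)‖ ≤ (q + 1) * ‖X k‖ + r := h3.trans (le_of_eq (by rw [hq, hr]; ring))
      have h5 : q + 1 ≤ Real.exp q := Real.add_one_le_exp q
      have h6 : (1 : ℝ) ≤ Real.exp ((k + 1) * q) := Real.one_le_exp (by positivity)
      push_cast
      calc ‖X (k + 1)‖ ≤ (q + 1) * ‖X k‖ + r := h4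
        _ ≤ Real.exp q * ((‖x₀‖ + k * r) * Real.exp (k * q)) + r * Real.exp ((k + 1) * q) := by
          gcongr
          exact le_mul_of_one_le_right hr0 h6
        _ = (‖x₀‖ + (k + 1) * r) * Real.exp ((k + 1) * q) := by
          rw [add_mul (k : ℝ) 1 q, one_mul, Real.exp_add]
          ring
  refine (key k hk).trans ?_
  have h1 : k * h ≤ T := by rw [← hT]; gcongr
  have h2 : (k : ℝ) * (h * (C * (C * ‖b‖))) ≤ T * (C * (C * ‖b‖)) := by
    rw [← mul_assoc]; gcongr
  have h3 : (k : ℝ) * (h * C ^ 3) ≤ T * C ^ 3 := by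
    rw [← mul_assoc]; gcongr
  have : 0 ≤ T := le_trans (by positivity) h1
  gcongr

/-- Discrete states are bounded, have bounded increments, and satisfy a discrete evolution
variational inequality, all uniformly in the number of layers. -/
theorem exists_discreteState_estimates (h0 : (0 : Vec n) ∈ subdiff R 0)
    (hne : ∀ w, (subdiff R w).Nonempty) {M : ℝ} (hM : 0 < M)
    (hgrowth : ∀ x : Vec n, (∀ z ∈ subdiff R x, ‖z‖ ≤ M * ‖x‖) ∨ (∀ z ∈ subdiff R x, ‖z‖ ≤ M))
    (b : Vec m) (x₀ : Vec n) (hT0 : 0 ≤ T) (hC : 0 ≤ C) :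
    ∃ B K : ℝ, 0 ≤ B ∧ 0 ≤ K ∧ ∀ (N : ℕ) (h : ℝ) (A : ℕ → Mat m n) (α lam : ℕ → ℝ) (X : ℕ → Vec n),
      0 < h → N * h = T → ParamBound C N A α lam → IsDiscreteState R h b x₀ N A α lam X →
      (∀ k ≤ N, ‖X k‖ ≤ B) ∧ (∀ k < N, ‖X (k + 1) - X k‖ ≤ K * h) ∧
      ∀ z, ∀ k < N, 1 / 2 * ‖X (k + 1) - z‖ ^ 2 - 1 / 2 * ‖X k - z‖ ^ 2
        ≤ h * eviRate R b z ((A k, α k, lam k), X k) + K ^ 2 * h ^ 2 := by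
  set B : ℝ := (‖x₀‖ + T * (C * (C * ‖b‖))) * Real.exp (T * C ^ 3) with hB
  have hB0 : 0 ≤ B := by positivity
  set D : ℝ := C * (C * B + ‖b‖) with hD
  set G : ℝ := M * (1 + B) with hG
  have hD0 : 0 ≤ D := by positivity
  have hG0 : 0 ≤ G := by positivity
  refine ⟨B, C * D + C * C * G, hB0, by positivity, fun N h A α lam X hh hT hp hX => ?_⟩
  have hXB : ∀ k ≤ N, ‖X k‖ ≤ B := fun k hk => hX.norm_le h0 hh hT hC hp hk
  have hgrad : ∀ k < N, ‖dataGrad (A k) b (X k)‖ ≤ D := fun k hk =>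
    (norm_dataGrad_le _ _ _).trans (by
      have := (hp k hk).1
      have := hXB k hk.le
      rw [hD]
      gcongr)
  have hinc : ∀ k < N, ‖X (k + 1) - X k‖ ≤ (C * D + C * C * G) * h := by
    intro k hk
    obtain ⟨hA, ⟨hα0, hα⟩, hl0, hl⟩ := hp k hk
    obtain ⟨g, hg, hx⟩ := hX.2 k hk
    have h1 : X (k + 1) - X k
        = -((h * α k) • dataGrad (A k) b (X k) + (h * α k * lam k) • g) := by
      rw [← sub_eq_zero, ← hx]; abel
    rw [h1, norm_neg]
    refine (norm_add_le _ _).trans ?_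
    rw [norm_smul, norm_smul, Real.norm_eq_abs, Real.norm_eq_abs, abs_of_nonneg (by positivity),
      abs_of_nonneg (by positivity)]
    have h2 := hgrad k hk
    have h3 : ‖g‖ ≤ G := norm_subdiff_le_of_growth hM hgrowth (hXB (k + 1) hk) hg
    calc h * α k * ‖dataGrad (A k) b (X k)‖ + h * α k * lam k * ‖g‖
        ≤ h * C * D + h * C * C * G := by gcongr
      _ = _ := by ring
  refine ⟨hXB, hinc, fun z k hk => ?_⟩
  obtain ⟨hA, ⟨hα0, hα⟩, hl0, hl⟩ := hp k hk
  obtain ⟨g, hg, hx⟩ := hX.2 k hk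
  -- The implicit step provides a subgradient at `X (k + 1)`, while `eviRate` is evaluated at `X k`;
  -- the subgradient `g'` at `X k` bounds `R (X k) - R (X (k + 1))` by a multiple of `h`.
  obtain ⟨g', hg'⟩ := hne (X k)
  have hinck := hinc k hk
  set K := C * D + C * C * G with hK
  set d := X (k + 1) - X k with hd
  set v := dataGrad (A k) b (X k) with hv
  have hdeq : d = -((h * α k) • v + (h * α k * lam k) • g) := by
    rw [← sub_eq_zero, ← hx]; abel
  -- The discarded term is `-½ ‖d‖²`.
  have h1 : 1 / 2 * ‖X (k + 1) - z‖ ^ 2 - 1 / 2 * ‖X k - z‖ ^ 2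
      ≤ inner ℝ d (X (k + 1) - z) := by
    have e : X k - z = (X (k + 1) - z) - d := by rw [hd]; abel
    rw [e, norm_sub_sq_real (X (k + 1) - z) d, real_inner_comm d (X (k + 1) - z)]
    linarith [sq_nonneg ‖d‖]
  have h2 : inner ℝ d (X (k + 1) - z) = -(h * α k * inner ℝ v (X k - z))
      - h * α k * inner ℝ v d - h * α k * lam k * inner ℝ g (X (k + 1) - z) := by
    have e : X (k + 1) - z = (X k - z) + d := by rw [hd]; abel
    rw [hdeq, inner_neg_left, inner_add_left, inner_smul_left, inner_smul_left, ← hdeq]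
    nth_rw 1 [e]
    rw [inner_add_right]
    simp only [conj_trivial]
    ring
  have h3 : -inner ℝ v d ≤ D * (K * h) := by
    have := (abs_le.1 (abs_real_inner_le_norm v d)).1
    have h4 : ‖v‖ * ‖d‖ ≤ D * (K * h) := by
      gcongr
      exact hgrad k hk
    linarith
  have h4 : -inner ℝ g (X (k + 1) - z) ≤ R z - R (X k) + G * (K * h) := by
    have h5 := hg z
    rw [← neg_sub (X (k + 1)) z, inner_neg_right] at h5
    have h6 := hg' (X (k + 1))
    have h7 := (abs_le.1 (abs_real_inner_le_norm g' d)).1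
    have h8 : ‖g'‖ * ‖d‖ ≤ G * (K * h) := by
      gcongr
      exact norm_subdiff_le_of_growth hM hgrowth (hXB k hk.le) hg'
    linarith
  have hα' : 0 ≤ h * α k := by positivity
  have hαl : 0 ≤ h * α k * lam k := by positivity
  have h5 := mul_le_mul_of_nonneg_left h3 hα'
  have h6 := mul_le_mul_of_nonneg_left h4 hαl
  have h7 : h * α k * (D * (K * h)) ≤ h * C * (D * (K * h)) := by gcongr
  have h8 : h * α k * lam k * (G * (K * h)) ≤ h * C * C * (G * (K * h)) := by gcongr
  -- The two replacement errors sum to `h (C D + C² G) K h`, and the bracket is `K` itself.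
  have h9 : h * C * (D * (K * h)) + h * C * C * (G * (K * h)) = K ^ 2 * h ^ 2 := by
    rw [hK]; ring
  simp only [eviRate]
  rw [← hv]
  linarith

/-- If `i` and `j` are the cells of `s` and `t`, then `(j - i) h` exceeds `t - s` by at most one
step `h`. -/
theorem norm_stepFun_sub_le (hh : 0 < h) (hT : N * h = T) {K : ℝ} (hK : 0 ≤ K)
    (hinc : ∀ k < N, ‖X (k + 1) - X k‖ ≤ K * h) {s t : ℝ} (hs : 0 ≤ s) (hst : s ≤ t) (ht : t ≤ T) :
    ‖stepFun h X t - stepFun h X s‖ ≤ K * (t - s + h) := by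
  set i := ⌊s / h⌋₊ with hi
  set j := ⌊t / h⌋₊ with hj
  have hij : i ≤ j := Nat.floor_le_floor (by gcongr)
  have hjN : j ≤ N := floor_div_le hh hT ht
  have hsi := mem_cell_floor hh hs
  have htj := mem_cell_floor hh (hs.trans hst)
  rw [← hi] at hsi
  rw [← hj] at htj
  change ‖X j - X i‖ ≤ _
  rw [← Finset.sum_Ico_sub X hij]
  refine (norm_sum_le_of_le _ fun k hk => hinc k ((Finset.mem_Ico.1 hk).2.trans_le hjN)).trans ?_
  rw [Finset.sum_const, Nat.card_Ico, nsmul_eq_mul, Nat.cast_sub hij, mul_left_comm]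
  gcongr
  linarith [hsi.2, htj.1]

end DiscreteState

/-! ### Arzelà–Ascoli along an ultrafilter -/

section UltraLimit

/-- A bounded family of functions whose moduli of continuity are Lipschitz up to an error tending
to zero converges uniformly along any ultrafilter, to a Lipschitz function. -/
theorem exists_lipschitz_ultrafilter_limit {E ι : Type*} [NormedAddCommGroup E] [ProperSpace E]
    (U : Ultrafilter ι) {T B K : ℝ} (hT : 0 ≤ T) (hK : 0 ≤ K) {h : ι → ℝ}
    (hh : Tendsto h U (𝓝 0)) {f : ι → ℝ → E} (hB : ∀ i, ∀ t ∈ Icc 0 T, ‖f i t‖ ≤ B)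
    (hf : ∀ i s t, 0 ≤ s → s ≤ t → t ≤ T → ‖f i t - f i s‖ ≤ K * (t - s + h i)) :
    ∃ x : ℝ → E, LipschitzWith K.toNNReal x ∧ (∀ t, ‖x t‖ ≤ B) ∧
      (∀ t ∈ Icc 0 T, Tendsto (fun i => f i t) U (𝓝 (x t))) ∧
      ∀ ε > 0, ∀ᶠ i in U, ∀ t ∈ Icc 0 T, ‖f i t - x t‖ ≤ ε := by
  -- Compactness of closed balls gives a pointwise limit at every time simultaneously, so no
  -- diagonal extraction is needed.
  have hlim : ∀ t : Icc (0 : ℝ) T, ∃ y : E, ‖y‖ ≤ B ∧ Tendsto (fun i => f i t) U (𝓝 y) := by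
    intro t
    obtain ⟨y, hy, hle⟩ := (isCompact_closedBall (0 : E) B).ultrafilter_le_nhds'
      (U.map fun i => f i t) (by
        refine Ultrafilter.mem_map.2 (Filter.Eventually.of_forall fun i => ?_)
        simpa using hB i t t.2)
    exact ⟨y, by simpa using hy, hle⟩
  choose y hyB hy using hlim
  have hf' : ∀ i, ∀ s ∈ Icc 0 T, ∀ t ∈ Icc 0 T, ‖f i t - f i s‖ ≤ K * (|t - s| + h i) := by
    intro i s hs t ht
    rcases le_total s t with hst | hst
    · rw [abs_of_nonneg (sub_nonneg.2 hst)]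
      exact hf i s t hs.1 hst ht.2
    · rw [abs_sub_comm, abs_of_nonneg (sub_nonneg.2 hst), norm_sub_rev]
      exact hf i t s ht.1 hst hs.2
  have hyK : ∀ s t : Icc (0 : ℝ) T, ‖y t - y s‖ ≤ K * |(t : ℝ) - s| := by
    intro s t
    have h1 : Tendsto (fun i => K * (|(t : ℝ) - s| + h i)) U (𝓝 (K * (|(t : ℝ) - s| + 0))) :=
      (tendsto_const_nhds.add hh).const_mul K
    rw [add_zero] at h1
    exact le_of_tendsto_of_tendsto' ((hy t).sub (hy s)).norm h1 fun i => hf' i s s.2 t t.2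
  -- Clamping time to `[0,T]` makes the limit Lipschitz on all of `ℝ`.
  set x : ℝ → E := fun t => y (projIcc 0 T hT t) with hx
  have hxy : ∀ t (ht : t ∈ Icc 0 T), x t = y ⟨t, ht⟩ := fun t ht => by
    rw [hx]; simp only [projIcc_of_mem hT ht]
  have hxlim : ∀ t ∈ Icc 0 T, Tendsto (fun i => f i t) U (𝓝 (x t)) := fun t ht => by
    rw [hxy t ht]; exact hy ⟨t, ht⟩
  refine ⟨x, ?_, fun t => hyB _, hxlim, fun ε hε => ?_⟩
  · refine LipschitzWith.of_dist_le_mul fun t s => ?_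
    rw [dist_eq_norm, Real.coe_toNNReal _ hK]
    refine (hyK _ _).trans ?_
    gcongr
    exact abs_projIcc_sub_projIcc hT
  -- Chosen so that `K δ ≤ ε / 4`: the final estimate contains `3 K δ` and one error `ε / 4` at a
  -- net point.
  · set δ := ε / (4 * (K + 1)) with hδ
    have hδ0 : 0 < δ := by positivity
    obtain ⟨S, hS, hSf, hcov⟩ := Metric.finite_approx_of_totallyBounded
      (isCompact_Icc (a := (0 : ℝ)) (b := T)).totallyBounded δ hδ0
    have h1 : ∀ᶠ i in (U : Filter ι), ∀ s ∈ S, ‖f i s - x s‖ < ε / 4 :=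
      (hSf.eventually_all).2 fun s hs => by
        have := (hxlim s (hS hs)).sub_const (x s)
        rw [sub_self] at this
        exact (tendsto_zero_iff_norm_tendsto_zero.1 this).eventually (gt_mem_nhds (by positivity))
    filter_upwards [h1, hh.eventually (gt_mem_nhds hδ0)] with i hi hhi t ht
    obtain ⟨s, hsS, hst⟩ := mem_iUnion₂.1 (hcov ht)
    rw [Metric.mem_ball, Real.dist_eq] at hst
    have h2 := hf' i s (hS hsS) t ht
    have h3 : ‖x t - x s‖ ≤ K * |t - s| := by
      rw [hxy t ht, hxy s (hS hsS)]; exact hyK ⟨s, hS hsS⟩ ⟨t, ht⟩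
    have h4 := hi s hsS
    have h5 : f i t - x t = (f i t - f i s) + (f i s - x s) - (x t - x s) := by abel
    have h6 : ‖f i t - x t‖ ≤ ‖f i t - f i s‖ + ‖f i s - x s‖ + ‖x t - x s‖ := by
      rw [h5]
      exact (norm_sub_le _ _).trans (by gcongr; exact norm_add_le _ _)
    have h7 : K * |t - s| ≤ K * δ := by gcongr
    have h8 : K * (|t - s| + h i) ≤ K * (δ + δ) := by gcongr
    have h9 : K * δ ≤ ε / 4 := by
      rw [hδ, mul_div_assoc', div_le_div_iff₀ (by positivity) (by positivity)]
      nlinarith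
    linarith

end UltraLimit

/-! ### The limit system: characterization, uniqueness and convergence of states -/

section LimitSystem

variable {m n : ℕ} {R : Vec n → ℝ} {b : Vec m} {x₀ : Vec n} {T C : ℝ}
  {A : ℝ → Mat m n} {α lam : ℝ → ℝ}

/-- Measurable, bounded controls with nonnegative step sizes and regularization parameters. -/
structure IsAdmissible (T C : ℝ) (A : ℝ → Mat m n) (α lam : ℝ → ℝ) : Prop where
  meas_mat : AEStronglyMeasurable A (volume.restrict (Icc 0 T))
  meas_step : AEStronglyMeasurable α (volume.restrict (Icc 0 T))
  meas_reg : AEStronglyMeasurable lam (volume.restrict (Icc 0 T))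
  bound : ∀ᵐ t ∂(volume.restrict (Icc 0 T)),
    ‖A t‖ ≤ C ∧ (0 ≤ α t ∧ α t ≤ C) ∧ (0 ≤ lam t ∧ lam t ≤ C)

/-- Provides one compact set containing the parameters and states of all networks and of the limit.
-/
theorem norm_prod_le_of_bounds {C B : ℝ} (hC : 0 ≤ C) (hB : 0 ≤ B) {M : Mat m n} {a l : ℝ}
    {x : Vec n} (h : ‖M‖ ≤ C ∧ (0 ≤ a ∧ a ≤ C) ∧ (0 ≤ l ∧ l ≤ C)) (hx : ‖x‖ ≤ B) :
    ((M, a, l), x) ∈ Metric.closedBall (0 : (Mat m n × ℝ × ℝ) × Vec n) (C + B) := by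
  obtain ⟨h1, ⟨h2, h3⟩, h4, h5⟩ := h
  rw [mem_closedBall_zero_iff]
  refine norm_prod_le_iff.2 ⟨norm_prod_le_iff.2 ⟨?_, norm_prod_le_iff.2 ⟨?_, ?_⟩⟩, ?_⟩
  · exact h1.trans (by linarith)
  · simp only [Real.norm_eq_abs, abs_of_nonneg h2]; linarith
  · simp only [Real.norm_eq_abs, abs_of_nonneg h4]; linarith
  · exact hx.trans (by linarith)

/-- A Lipschitz curve satisfying the evolution variational inequality in integrated form solves
the differential inclusion. -/
theorem isLimitState_of_antitoneOn (hR : Continuous R) (hne : ∀ w, (subdiff R w).Nonempty)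
    (hT : 0 < T) {K : NNReal} {x : ℝ → Vec n} (hx : LipschitzWith K x) (hx0 : x 0 = x₀)
    (hα : ∀ᵐ t ∂(volume.restrict (Icc 0 T)), 0 ≤ α t ∧ 0 ≤ lam t)
    (hint : ∀ z, IntervalIntegrable (fun t => eviRate R b z ((A t, α t, lam t), x t)) volume 0 T)
    (hanti : ∀ z, AntitoneOn (fun t => 1 / 2 * ‖x t - z‖ ^ 2
      - ∫ τ in 0..t, eviRate R b z ((A τ, α τ, lam τ), x τ)) (Icc 0 T)) :
    IsLimitState R T b x₀ A α lam x := by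
  refine ⟨(hx.lipschitzOnWith).absolutelyContinuousOnInterval, hx0, ?_⟩
  -- The null set of bad times in Lebesgue differentiation depends on `z`; a countable dense set of
  -- test points gives a common one, and continuity in `z` then extends the pointwise inequality.
  obtain ⟨S, hSc, hSd⟩ := TopologicalSpace.exists_countable_dense (Vec n)
  have h1 : ∀ᵐ t, ∀ z ∈ S, t ∈ uIcc 0 T → ∀ c ∈ uIcc 0 T,
      HasDerivAt (fun s => ∫ τ in c..s, eviRate R b z ((A τ, α τ, lam τ), x τ))
        (eviRate R b z ((A t, α t, lam t), x t)) t :=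
    (ae_ball_iff hSc).2 fun z _ => (hint z).ae_hasDerivAt_integral
  rw [ae_restrict_Icc_iff_Ioc] at hα ⊢
  filter_upwards [h1, hx.ae_differentiableAt, hα, Measure.ae_ne volume T]
    with t ht hdiff hαt htT htm
  obtain ⟨hα0, hl0⟩ := hαt htm
  have htmem : t ∈ Icc 0 T := Ioc_subset_Icc_self htm
  set v := deriv x t with hv
  have hxv : HasDerivAt x v t := hdiff.hasDerivAt
  refine ⟨v, hxv, ?_⟩
  have hS : ∀ z ∈ S, inner ℝ (x t - z) v ≤ eviRate R b z ((A t, α t, lam t), x t) := by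
    intro z hz
    have h2 := ht z hz (by rwa [uIcc_of_le hT.le]) 0 left_mem_uIcc
    have h3 : HasDerivAt (fun s => 1 / 2 * ‖x s - z‖ ^ 2) (1 / 2 * (2 * inner ℝ (x t - z) v)) t :=
      ((hxv.sub_const z).norm_sq).const_mul _
    have h4 := (h3.sub h2).hasDerivWithinAt (s := Icc 0 T)
    have h5 : AccPt t (𝓟 (Icc 0 T)) :=
      uniqueDiffWithinAt_iff_accPt.1 (uniqueDiffOn_Icc hT t htmem)
    have h6 := h4.nonpos_of_antitoneOn h5 (hanti z)
    linarith
  have hall : ∀ z, inner ℝ (x t - z) v ≤ eviRate R b z ((A t, α t, lam t), x t) := by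
    intro z
    have hc1 : Continuous fun z => inner ℝ (x t - z) v := by fun_prop
    have hc2 : Continuous fun z => eviRate R b z ((A t, α t, lam t), x t) := by
      unfold eviRate; fun_prop
    exact closure_minimal (fun z hz => hS z hz) (isClosed_le hc1 hc2) (hSd z)
  set G := dataGrad (A t) b (x t) with hG
  have hall' : ∀ z, inner ℝ (v + α t • G) (x t - z) ≤ α t * lam t * (R z - R (x t)) := by
    intro z
    have := hall z
    simp only [eviRate, ← hG] at this
    rw [inner_add_left, inner_smul_left, real_inner_comm]
    simp only [conj_trivial]
    linarith
  -- If `α λ = 0`, testing with `z = x - (v + α G)` forces `v + α G = 0`, and any subgradient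
  -- serves. Otherwise dividing by `α λ` shows that `-(v + α G) / (α λ)` is a subgradient.
  rcases (mul_nonneg hα0 hl0).eq_or_lt with hc | hc
  · obtain ⟨g, hg⟩ := hne (x t)
    refine ⟨g, hg, ?_⟩
    have := hall' (x t - (v + α t • G))
    rw [← hc, zero_mul, sub_sub_cancel, real_inner_self_eq_norm_sq] at this
    have h0 : v + α t • G = 0 := by
      rw [← norm_eq_zero]
      exact pow_eq_zero_iff two_ne_zero |>.1 (le_antisymm this (sq_nonneg _))
    rw [← hc, zero_smul, add_zero, h0]
  · refine ⟨-((α t * lam t)⁻¹ • (v + α t • G)), fun z => ?_, ?_⟩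
    · have h2 := mul_le_mul_of_nonneg_left (hall' z) (inv_nonneg.2 hc.le)
      rw [inv_mul_cancel_left₀ hc.ne'] at h2
      rw [← neg_sub (x t) z, inner_neg_neg, inner_smul_left]
      simp only [conj_trivial]
      linarith
    · rw [smul_neg, smul_smul, mul_inv_cancel₀ hc.ne', one_smul, add_neg_cancel]

/-- The limit system has at most one solution. -/
theorem IsLimitState.eqOn (hT : 0 < T)
    (hα : ∀ᵐ t ∂(volume.restrict (Icc 0 T)), 0 ≤ α t ∧ 0 ≤ lam t) {x y : ℝ → Vec n}
    (hx : IsLimitState R T b x₀ A α lam x) (hy : IsLimitState R T b x₀ A α lam y) :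
    EqOn x y (Icc 0 T) := by
  intro t ht
  -- The function `‖x - y‖²` is absolutely continuous, vanishes at `0`, and has a.e. nonpositive
  -- derivative because both parts of the right-hand side are monotone.
  have hd : AbsolutelyContinuousOnInterval (fun s => ‖x s - y s‖) 0 T := by
    refine squeeze_zero (fun _ => Finset.sum_nonneg fun _ _ => dist_nonneg)
      (fun E => Finset.sum_le_sum fun i _ => ?_) (hx.1.sub hy.1)
    simp only [dist_eq_norm, Pi.sub_apply]
    exact abs_norm_sub_norm_le _ _
  have hf := (hd.mul hd).mono (c := 0) (d := t) (by
    rw [uIcc_of_le ht.1, uIcc_of_le hT.le]; exact Icc_subset_Icc le_rfl ht.2)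
  have h1 := hf.integral_deriv_eq_sub
  have h2 : ∫ s in 0..t, deriv ((fun s => ‖x s - y s‖) * fun s => ‖x s - y s‖) s ≤ 0 := by
    rw [← neg_nonneg, ← intervalIntegral.integral_neg]
    refine intervalIntegral.integral_nonneg_of_ae_restrict ht.1 ?_
    have hsub : Icc 0 t ⊆ Icc 0 T := Icc_subset_Icc le_rfl ht.2
    have hα' := ae_restrict_of_ae_restrict_of_subset hsub hα
    filter_upwards [hα', ae_restrict_of_ae_restrict_of_subset hsub hx.2.2,
      ae_restrict_of_ae_restrict_of_subset hsub hy.2.2] with s hαs hxs hys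
    obtain ⟨v, hv, g, hg, hvg⟩ := hxs
    obtain ⟨w, hw, g', hg', hwg⟩ := hys
    have h3 : HasDerivAt ((fun s => ‖x s - y s‖) * fun s => ‖x s - y s‖)
        (2 * inner ℝ (x s - y s) (v - w)) s := by
      convert (hv.fun_sub hw).norm_sq using 1
      ext s
      simp [sq]
    have h4 : v - w = -(α s • (dataGrad (A s) b (x s) - dataGrad (A s) b (y s))
        + (α s * lam s) • (g - g')) := by
      rw [← sub_eq_zero, ← sub_eq_zero.2 (hvg.trans hwg.symm), smul_sub, smul_sub]
      abel
    have h5 := mul_nonneg hαs.1 (inner_dataGrad_sub_nonneg (A s) b (x s) (y s))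
    have h6 := mul_nonneg (mul_nonneg hαs.1 hαs.2) (inner_sub_sub_nonneg_of_mem_subdiff hg hg')
    simp only [Pi.zero_apply]
    rw [h3.deriv, h4, inner_neg_right, inner_add_right, inner_smul_right, inner_smul_right,
      real_inner_comm, real_inner_comm (g - g')]
    linarith
  have h7 : ‖x t - y t‖ * ‖x t - y t‖ ≤ 0 := by
    have : x 0 - y 0 = 0 := by rw [hx.2.1, hy.2.1, sub_self]
    simp only [Pi.mul_apply, this, norm_zero, mul_zero, sub_zero] at h1
    linarith
  rw [← sub_eq_zero, ← norm_eq_zero]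
  exact mul_self_eq_zero.1 (le_antisymm h7 (mul_self_nonneg _))

/-- Along any ultrafilter, discrete states whose parameters converge in `L¹` converge to a solution
of the limit system. -/
theorem exists_isLimitState_of_tendsto (hRc : ConvexOn ℝ univ R)
    (h0 : (0 : Vec n) ∈ subdiff R 0) (hne : ∀ w, (subdiff R w).Nonempty) {M : ℝ} (hM : 0 < M)
    (hgrowth : ∀ x : Vec n, (∀ z ∈ subdiff R x, ‖z‖ ≤ M * ‖x‖) ∨ (∀ z ∈ subdiff R x, ‖z‖ ≤ M))
    (hT : 0 < T) (hC : 0 ≤ C) (hadm : IsAdmissible T C A α lam)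
    {ι : Type*} (U : Ultrafilter ι) {N : ι → ℕ} (hN : ∀ i, 1 ≤ N i) (hNU : Tendsto N U atTop)
    {a : ι → ℕ → Mat m n} {r l : ι → ℕ → ℝ} (hbd : ∀ i, ParamBound C (N i) (a i) (r i) (l i))
    (ha : Tendsto (fun i => ∫ t in 0..T, ‖stepFun (T / N i) (a i) t - A t‖) U (𝓝 0))
    (hr : Tendsto (fun i => ∫ t in 0..T, ‖stepFun (T / N i) (r i) t - α t‖) U (𝓝 0))
    (hl : Tendsto (fun i => ∫ t in 0..T, ‖stepFun (T / N i) (l i) t - lam t‖) U (𝓝 0))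
    {X : ι → ℕ → Vec n}
    (hX : ∀ i, IsDiscreteState R (T / N i) b x₀ (N i) (a i) (r i) (l i) (X i)) :
    ∃ x, IsLimitState R T b x₀ A α lam x ∧ Tendsto (fun i => X i (N i)) U (𝓝 (x T)) := by
  have hN' : ∀ i, (0 : ℝ) < N i := fun i => by exact_mod_cast hN i
  have hh : ∀ i, 0 < T / N i := fun i => div_pos hT (hN' i)
  have hNh : ∀ i, N i * (T / N i) = T := fun i => mul_div_cancel₀ _ (hN' i).ne'
  have hhU : Tendsto (fun i => T / (N i : ℝ)) U (𝓝 0) :=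
    (tendsto_natCast_atTop_atTop.comp hNU).const_div_atTop T
  obtain ⟨B, K, hB, hK, hest⟩ :=
    exists_discreteState_estimates h0 hne hM hgrowth b x₀ hT.le hC
  have hest' := fun i => hest (N i) (T / N i) (a i) (r i) (l i) (X i) (hh i) (hNh i) (hbd i) (hX i)
  set f : ι → ℝ → Vec n := fun i => stepFun (T / N i) (X i) with hf
  have hfB : ∀ i, ∀ t ∈ Icc 0 T, ‖f i t‖ ≤ B := fun i t ht =>
    (hest' i).1 _ (floor_div_le (hh i) (hNh i) ht.2)
  obtain ⟨x, hxK, hxB, hxlim, hxunif⟩ := exists_lipschitz_ultrafilter_limit U hT.le hK hhU hfB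
    fun i s t hs hst ht => norm_stepFun_sub_le (hh i) (hNh i) hK (hest' i).2.1 hs hst ht
  have hf0 : ∀ i, f i 0 = x₀ := fun i => by
    simp only [hf, stepFun, zero_div, Nat.floor_zero, (hX i).1]
  have hfT : ∀ i, f i T = X i (N i) := fun i => by
    have : T / (T / (N i : ℝ)) = N i := by
      have := (hN' i).ne'
      field_simp
    simp only [hf, stepFun, this, Nat.floor_natCast]
  have hx0 : x 0 = x₀ := by
    refine tendsto_nhds_unique (hxlim 0 ⟨le_rfl, hT.le⟩) ?_
    simp only [hf0]
    exact tendsto_const_nhds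
  refine ⟨x, ?_, by simpa only [hfT] using hxlim T ⟨hT.le, le_rfl⟩⟩
  -- the triple of parameters and the state, as one function
  set μ : Measure ℝ := volume.restrict (Icc 0 T) with hμ
  set q : ι → ℝ → (Mat m n × ℝ × ℝ) × Vec n :=
    fun i => stepFun (T / N i) fun k => ((a i k, r i k, l i k), X i k) with hq
  set v : ℝ → (Mat m n × ℝ × ℝ) × Vec n := fun t => ((A t, α t, lam t), x t) with hv
  set Q := Metric.closedBall (0 : (Mat m n × ℝ × ℝ) × Vec n) (C + B) with hQ
  have hQc : IsCompact Q := isCompact_closedBall _ _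
  have hqmem : ∀ i, ∀ k < N i, ((a i k, r i k, l i k), X i k) ∈ Q := fun i k hk =>
    norm_prod_le_of_bounds hC hB (hbd i k hk) ((hest' i).1 k hk.le)
  have hqQ : ∀ i, ∀ᵐ t ∂μ, q i t ∈ Q := fun i => ae_restrict_Icc_iff_Ioc.2
    (ae_uIoc_zero_floor (P := fun k _ => ((a i k, r i k, l i k), X i k) ∈ Q) (hh i) (hNh i)
      fun k hk _ _ => hqmem i k hk)
  have hvQ : ∀ᵐ t ∂μ, v t ∈ Q :=
    hadm.bound.mono fun t ht => norm_prod_le_of_bounds hC hB ht (hxB t)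
  have hqm : ∀ i, AEStronglyMeasurable (q i) μ := fun i =>
    (stronglyMeasurable_stepFun _ _).aestronglyMeasurable
  have hvm : AEStronglyMeasurable v μ :=
    (hadm.meas_mat.prodMk (hadm.meas_step.prodMk hadm.meas_reg)).prodMk
      hxK.continuous.aestronglyMeasurable
  -- Parameters converge in `L¹` by hypothesis and states uniformly; the sum of the four component
  -- norms dominates the sup norm of the product.
  have hconv : Tendsto (fun i => ∫ t, ‖q i t - v t‖ ∂μ) U (𝓝 0) := by
    have hI : ∀ g : ℝ → ℝ, ∫ t in 0..T, g t = ∫ t, g t ∂μ := fun g => by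
      rw [intervalIntegral.integral_of_le hT.le, hμ, integral_Icc_eq_integral_Ioc]
    have hfx : Tendsto (fun i => ∫ t, ‖f i t - x t‖ ∂μ) U (𝓝 0) := by
      rw [Metric.tendsto_nhds]
      intro ε hε
      filter_upwards [hxunif (ε / (2 * T)) (by positivity)] with i hi
      have h1 : ‖∫ t in Icc 0 T, ‖f i t - x t‖‖ ≤ ε / (2 * T) * volume.real (Icc 0 T) :=
        norm_setIntegral_le_of_norm_le_const (by simp) fun t ht => by
          rw [norm_norm]; exact hi t ht
      rw [Real.volume_real_Icc_of_le hT.le, sub_zero,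
        show ε / (2 * T) * T = ε / 2 by field_simp] at h1
      rw [dist_zero_right]
      linarith
    simp only [hI] at ha hr hl
    have h1 := ((ha.add hr).add hl).add hfx
    simp only [add_zero] at h1
    refine squeeze_zero (fun i => integral_nonneg fun t => norm_nonneg _) (fun i => ?_) h1
    have hqv := (integrable_of_mem_compact hQc (hqm i) (hqQ i)).sub
      (integrable_of_mem_compact hQc hvm hvQ)
    have i1 : Integrable (fun t => ‖stepFun (T / N i) (a i) t - A t‖) μ := hqv.fst.fst.norm
    have i2 : Integrable (fun t => ‖stepFun (T / N i) (r i) t - α t‖) μ := hqv.fst.snd.fst.norm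
    have i3 : Integrable (fun t => ‖stepFun (T / N i) (l i) t - lam t‖) μ :=
      hqv.fst.snd.snd.norm
    have i4 : Integrable (fun t => ‖f i t - x t‖) μ := hqv.snd.norm
    rw [← integral_add i1 i2, ← integral_add (i1.fun_add i2) i3,
      ← integral_add ((i1.fun_add i2).fun_add i3) i4]
    refine integral_mono hqv.norm (((i1.fun_add i2).fun_add i3).fun_add i4) fun t => ?_
    have j1 := norm_nonneg (stepFun (T / N i) (a i) t - A t)
    have j2 := norm_nonneg (stepFun (T / N i) (r i) t - α t)
    have j3 := norm_nonneg (stepFun (T / N i) (l i) t - lam t)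
    have j4 := norm_nonneg (f i t - x t)
    refine norm_prod_le_iff.2 ⟨norm_prod_le_iff.2 ⟨?_, norm_prod_le_iff.2 ⟨?_, ?_⟩⟩, ?_⟩
    · change ‖stepFun (T / N i) (a i) t - A t‖ ≤ _
      linarith
    · change ‖stepFun (T / N i) (r i) t - α t‖ ≤ _
      linarith
    · change ‖stepFun (T / N i) (l i) t - lam t‖ ≤ _
      linarith
    · change ‖f i t - x t‖ ≤ _
      linarith
  have hRcont := hRc.continuous_of_univ
  have hint : ∀ z, Integrable (fun t => eviRate R b z (v t)) μ := fun z =>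
    integrable_comp_of_mem_compact hQc (continuous_eviRate hRcont b z) hvm hvQ
  have hII : ∀ {g : ℝ → ℝ}, Integrable g μ → IntervalIntegrable g volume 0 T := fun {g} hg =>
    (intervalIntegrable_iff_integrableOn_Icc_of_le hT.le).2 hg
  refine isLimitState_of_antitoneOn hRcont hne hT hxK hx0
    (hadm.bound.mono fun t ht => ⟨ht.2.1.1, ht.2.2.1⟩) (fun z => hII (hint z)) fun z => ?_
  have hlim := tendsto_integral_abs_comp_sub hQc (continuous_eviRate hRcont b z) hqm hvm hqQ hvQ
    hconv
  obtain ⟨Φ, hΦ⟩ := hQc.exists_bound_of_continuousOn (continuous_eviRate hRcont b z).continuousOn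
  intro s hs t ht hst
  have hsub : ∀ {g : ℝ → ℝ}, IntervalIntegrable g volume 0 T → IntervalIntegrable g volume s t :=
    fun {g} hg => hg.mono_set (by rw [uIcc_of_le hT.le]; exact uIcc_subset_Icc hs ht)
  -- The summed discrete inequality with the limit integrand inserted: the replacement costs the
  -- `L¹` distance of the rates, and the discretization costs `O(h)`. Both vanish along `U`.
  have key : ∀ i, 1 / 2 * ‖f i t - z‖ ^ 2 - 1 / 2 * ‖f i s - z‖ ^ 2
      ≤ (∫ τ in s..t, eviRate R b z (v τ)) + (∫ τ, |eviRate R b z (q i τ) - eviRate R b z (v τ)| ∂μ)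
        + (2 * |Φ| + K ^ 2 * T) * (T / N i) := by
    intro i
    have h1 := stepFun_sub_le_integral (hh i) (hNh i) (S := fun k => 1 / 2 * ‖X i k - z‖ ^ 2)
      (φ := fun k => eviRate R b z ((a i k, r i k, l i k), X i k)) (sq_nonneg K)
      ((hest' i).2.2 z) (abs_nonneg Φ)
      (fun k hk => (hΦ _ (hqmem i k hk)).trans (le_abs_self Φ)) hs.1 hst ht.2
    change 1 / 2 * ‖f i t - z‖ ^ 2 - 1 / 2 * ‖f i s - z‖ ^ 2
      ≤ (∫ τ in s..t, eviRate R b z (q i τ)) + (2 * |Φ| + K ^ 2 * T) * (T / N i) at h1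
    have hqi : Integrable (fun t => eviRate R b z (q i t)) μ :=
      integrable_comp_of_mem_compact hQc (continuous_eviRate hRcont b z) (hqm i) (hqQ i)
    have h2 : (∫ τ in s..t, eviRate R b z (q i τ)) - ∫ τ in s..t, eviRate R b z (v τ)
        ≤ ∫ τ, |eviRate R b z (q i τ) - eviRate R b z (v τ)| ∂μ := by
      rw [← intervalIntegral.integral_sub (hsub (hII hqi)) (hsub (hII (hint z)))]
      refine (le_abs_self _).trans ((intervalIntegral.abs_integral_le_integral_abs hst).trans ?_)
      rw [intervalIntegral.integral_of_le hst]
      refine setIntegral_mono_set (hqi.sub (hint z)).abs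
        (Eventually.of_forall fun _ => abs_nonneg _) (LE.le.eventuallyLE ?_)
      exact Ioc_subset_Icc_self.trans (Icc_subset_Icc hs.1 ht.2)
    linarith
  have h1 : Tendsto (fun i => 1 / 2 * ‖f i t - z‖ ^ 2 - 1 / 2 * ‖f i s - z‖ ^ 2) U
      (𝓝 (1 / 2 * ‖x t - z‖ ^ 2 - 1 / 2 * ‖x s - z‖ ^ 2)) :=
    ((((hxlim t ht).sub_const z).norm.pow 2).const_mul _).sub
      ((((hxlim s hs).sub_const z).norm.pow 2).const_mul _)
  have h2 := (hlim.const_add (∫ τ in s..t, eviRate R b z (v τ))).add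
    (hhU.const_mul (2 * |Φ| + K ^ 2 * T))
  rw [add_zero, mul_zero, add_zero] at h2
  have h3 := le_of_tendsto_of_tendsto' h1 h2 key
  have h4 := intervalIntegral.integral_interval_sub_left (a := 0) (hII (hint z) |>.mono_set
    (uIcc_subset_uIcc_left (by rwa [uIcc_of_le hT.le] : t ∈ uIcc 0 T)))
    (hII (hint z) |>.mono_set (uIcc_subset_uIcc_left (by rwa [uIcc_of_le hT.le] : s ∈ uIcc 0 T)))
  simp only [hv] at h3 h4 ⊢
  linarith

end LimitSystem

/-! ### Projected controls and convergence of the regularization terms -/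

section Projection

variable {T : ℝ} {N : ℕ}

/-- The cells differ from half-open intervals only by endpoints, and the last one ends exactly at
`T`. -/
theorem proj_eq_cellMean {E : Type*} [NormedAddCommGroup E] [NormedSpace ℝ E] (hT : 0 < T)
    (V : ℝ → E) (k : Fin N) : proj T N V k = cellMean (T / N) V k := by
  have hN : (0 : ℝ) < N := by exact_mod_cast k.pos
  have hh : 0 < T / N := div_pos hT hN
  have hle : (k : ℝ) * (T / N) ≤ (k + 1) * (T / N) := by nlinarith
  have hcell : cell T N k =ᵐ[volume] Ioc ((k : ℝ) * (T / N)) ((k + 1) * (T / N)) := by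
    unfold cell
    split_ifs with hk
    · have h1 : ((k : ℝ) + 1) * (T / N) = T := by
        rw [show ((k : ℝ) + 1) = N by exact_mod_cast hk, mul_div_cancel₀ _ hN.ne']
      rw [h1]
      exact Ioc_ae_eq_Icc.symm
    · exact Ico_ae_eq_Ioc
  rw [proj, setAverage_congr hcell, setAverage_eq, Real.volume_real_Ioc_of_le hle, cellMean,
    intervalIntegral.integral_of_le hle]
  congr 2
  ring

/-- All cells have length `T / N`, so the mean over layers is the time average of a step function,
directly comparable with the continuous term. -/
theorem discreteReg_proj {E : Type*} [NormedAddCommGroup E] [NormedSpace ℝ E] (ψ : ℝ → ℝ) (p : ℝ)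
    (hT : 0 < T) (hN : 1 ≤ N) (V : ℝ → E) :
    discreteReg ψ p (proj T N V)
      = ψ (1 / T * ∫ t in Icc 0 T, ‖stepFun (T / N) (cellMean (T / N) V) t‖ ^ p) := by
  have hN' : (0 : ℝ) < N := by exact_mod_cast hN
  have hh : 0 < T / N := div_pos hT hN'
  have h1 := integral_stepFun hh (fun k => ‖cellMean (T / N) V k‖ ^ p) (Nat.zero_le N)
  rw [mul_div_cancel₀ _ hN'.ne', Nat.cast_zero, zero_mul,
    intervalIntegral.integral_of_le hT.le, ← integral_Icc_eq_integral_Ioc] at h1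
  have h2 : ∫ t in Icc 0 T, ‖stepFun (T / N) (cellMean (T / N) V) t‖ ^ p
      = ∑ k ∈ Finset.Ico 0 N, (T / N) • ‖cellMean (T / N) V k‖ ^ p := h1
  rw [discreteReg, h2, Nat.Ico_zero_eq_range, Finset.sum_range, ← Finset.smul_sum]
  simp only [proj_eq_cellMean hT, smul_eq_mul]
  congr 1
  field_simp

theorem norm_cellMean_le {E : Type*} [NormedAddCommGroup E] [NormedSpace ℝ E] [CompleteSpace E]
    (hT : 0 < T) {V : ℝ → E} {C : ℝ} (hV : AEStronglyMeasurable V (volume.restrict (Icc 0 T)))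
    (hVC : ∀ᵐ t ∂(volume.restrict (Icc 0 T)), ‖V t‖ ≤ C) {k : ℕ} (hk : k < N) :
    ‖cellMean (T / N) V k‖ ≤ C := by
  have hN' : (0 : ℝ) < N := by exact_mod_cast (Nat.zero_le k).trans_lt hk
  have hh : 0 < T / N := div_pos hT hN'
  have hNh : N * (T / N) = T := mul_div_cancel₀ _ hN'.ne'
  have hVi : IntervalIntegrable V volume 0 T :=
    (intervalIntegrable_iff_integrableOn_Icc_of_le hT.le).2 (Integrable.of_bound hV C hVC)
  have hk' : ((k : ℝ) + 1) * (T / N) ≤ T := by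
    refine le_trans ?_ hNh.le
    gcongr
    exact_mod_cast hk
  have := norm_cellMean_sub_le (v := (0 : E)) (D := C) hh
    (IntervalIntegrable.cell hh (by rwa [hNh]) hk) (by
      filter_upwards [ae_restrict_Icc_iff_Ioc.1 hVC] with s hs hm
      rw [sub_zero]
      exact hs ⟨lt_of_le_of_lt (by positivity) hm.1, hm.2.trans hk'⟩)
  rwa [sub_zero] at this

theorem cellMean_nonneg_of_ae (hT : 0 < T) {V : ℝ → ℝ}
    (hV : ∀ᵐ t ∂(volume.restrict (Icc 0 T)), 0 ≤ V t) {k : ℕ} (hk : k < N) :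
    0 ≤ cellMean (T / N) V k := by
  have hN' : (0 : ℝ) < N := by exact_mod_cast (Nat.zero_le k).trans_lt hk
  have hh : 0 < T / N := div_pos hT hN'
  have hk' : ((k : ℝ) + 1) * (T / N) ≤ T := by
    nth_rw 2 [← mul_div_cancel₀ T hN'.ne']; gcongr; exact_mod_cast hk
  refine cellMean_nonneg hh ?_
  filter_upwards [ae_restrict_Icc_iff_Ioc.1 hV] with s hs hm
  exact hs ⟨lt_of_le_of_lt (by positivity) hm.1, hm.2.trans hk'⟩

theorem tendsto_discreteReg_proj {E : Type*} [NormedAddCommGroup E] [NormedSpace ℝ E]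
    [ProperSpace E] {ψ : ℝ → ℝ} (hψ : Continuous ψ) {p : ℝ} (hp : 0 ≤ p) (hT : 0 < T) {C : ℝ}
    {ι : Type*} {l : Filter ι} {N : ι → ℕ} (hN : ∀ i, 1 ≤ N i) (hNl : Tendsto N l atTop)
    {W : ι → ℝ → E} {V : ℝ → E}
    (hW : ∀ i, AEStronglyMeasurable (W i) (volume.restrict (Icc 0 T)))
    (hV : AEStronglyMeasurable V (volume.restrict (Icc 0 T)))
    (hWC : ∀ i, ∀ᵐ t ∂(volume.restrict (Icc 0 T)), ‖W i t‖ ≤ C)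
    (hVC : ∀ᵐ t ∂(volume.restrict (Icc 0 T)), ‖V t‖ ≤ C)
    (hWV : Tendsto (fun i => ∫ t in Icc 0 T, ‖W i t - V t‖) l (𝓝 0)) :
    Tendsto (fun i => discreteReg ψ p (proj T (N i) (W i))) l (𝓝 (continuousReg ψ p T V)) := by
  have hI : ∀ g : ℝ → ℝ, ∫ t in 0..T, g t = ∫ t in Icc 0 T, g t := fun g => by
    rw [intervalIntegral.integral_of_le hT.le, integral_Icc_eq_integral_Ioc]
  have hII : ∀ {g : ℝ → E}, AEStronglyMeasurable g (volume.restrict (Icc 0 T)) →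
      (∀ᵐ t ∂(volume.restrict (Icc 0 T)), ‖g t‖ ≤ C) → IntervalIntegrable g volume 0 T :=
    fun {g} hg hgC =>
      (intervalIntegrable_iff_integrableOn_Icc_of_le hT.le).2 (Integrable.of_bound hg C hgC)
  have h1 := tendsto_integral_norm_stepFun_cellMean_sub_of_tendsto hT hN hNl (hII hV hVC)
    (fun i => hII (hW i) (hWC i)) (by simpa only [hI] using hWV)
  simp only [hI] at h1
  have hF : Continuous fun e : E => ‖e‖ ^ p := continuous_norm.rpow_const fun _ => Or.inr hp
  have hsm : ∀ i, AEStronglyMeasurable (stepFun (T / N i) (cellMean (T / N i) (W i)))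
      (volume.restrict (Icc 0 T)) := fun i =>
    (stronglyMeasurable_stepFun _ _).aestronglyMeasurable
  have hsQ : ∀ i, ∀ᵐ t ∂(volume.restrict (Icc 0 T)),
      stepFun (T / N i) (cellMean (T / N i) (W i)) t ∈ Metric.closedBall (0 : E) C := by
    intro i
    have hN' : (0 : ℝ) < N i := by exact_mod_cast hN i
    refine ae_restrict_Icc_iff_Ioc.2 (ae_uIoc_zero_floor
      (P := fun k _ => cellMean (T / N i) (W i) k ∈ Metric.closedBall (0 : E) C)
      (div_pos hT hN') (mul_div_cancel₀ _ hN'.ne') fun k hk _ _ => ?_)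
    rw [mem_closedBall_zero_iff]
    exact norm_cellMean_le hT (hW i) (hWC i) hk
  have hVQ : ∀ᵐ t ∂(volume.restrict (Icc 0 T)), V t ∈ Metric.closedBall (0 : E) C :=
    hVC.mono fun t ht => by rwa [mem_closedBall_zero_iff]
  have h2 := tendsto_integral_abs_comp_sub (isCompact_closedBall (0 : E) C) hF hsm hV hsQ hVQ h1
  have h3 : Tendsto (fun i => ∫ t in Icc 0 T, ‖stepFun (T / N i) (cellMean (T / N i) (W i)) t‖ ^ p)
      l (𝓝 (∫ t in Icc 0 T, ‖V t‖ ^ p)) := by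
    rw [tendsto_iff_norm_sub_tendsto_zero]
    refine squeeze_zero (fun i => norm_nonneg _) (fun i => ?_) h2
    rw [← integral_sub (integrable_comp_of_mem_compact (isCompact_closedBall (0 : E) C) hF
      (hsm i) (hsQ i)) (integrable_comp_of_mem_compact (isCompact_closedBall (0 : E) C) hF hV hVQ)]
    exact norm_integral_le_integral_norm _
  simp only [discreteReg_proj ψ p hT (hN _)]
  exact (hψ.tendsto _).comp (h3.const_mul (1 / T))

end Projection

/-! ### Network states and convergence of outputs -/

section Network

variable {m n : ℕ} {R : Vec n → ℝ} {b : Vec m} {x₀ : Vec n} {T C : ℝ}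

/-- The network recursion has exactly one state. -/
theorem existsUnique_isNetworkState (hR : ConvexOn ℝ univ R) (h0 : (0 : Vec n) ∈ subdiff R 0)
    (hne : ∀ w, (subdiff R w).Nonempty) (hT : 0 ≤ T) {N : ℕ} {A : Fin N → Mat m n}
    {α lam : Fin N → ℝ} (hα : ∀ k, 0 ≤ α k) (hlam : ∀ k, 0 ≤ lam k) :
    ∃! x : Fin (N + 1) → Vec n, IsNetworkState R T b x₀ A α lam x := by
  have hprox : ∀ k w, ∃! x, ∃ g ∈ subdiff R x,
      x - w + (T / N * α k) • dataGrad (A k) b w + (T / N * α k * lam k) • g = 0 := by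
    intro k w
    have hc : 0 ≤ T / N * α k * lam k :=
      mul_nonneg (mul_nonneg (by positivity) (hα k)) (hlam k)
    have := existsUnique_prox hR h0 hne hc (w - (T / N * α k) • dataGrad (A k) b w)
    simpa only [← sub_add] using this
  choose P hP hPu using hprox
  let x : Fin (N + 1) → Vec n := fun j => Fin.induction (motive := fun _ => Vec n) x₀ P j
  have hx0 : x 0 = x₀ := rfl
  have hxs : ∀ k : Fin N, x k.succ = P k (x k.castSucc) := fun k => Fin.induction_succ _ _ _
  refine ⟨x, ⟨hx0, fun k => ?_⟩, fun y hy => ?_⟩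
  · rw [hxs]
    exact hP k _
  · funext j
    induction j using Fin.induction with
    | zero => rw [hx0, hy.1]
    | succ k ih =>
      rw [hxs, ← ih]
      exact hPu k _ _ (hy.2 k)

theorem networkOutput_spec {N : ℕ} {A : Fin N → Mat m n} {α lam : Fin N → ℝ}
    (h : ∃ x, IsNetworkState R T b x₀ A α lam x) :
    ∃ x, IsNetworkState R T b x₀ A α lam x ∧ networkOutput R T b x₀ A α lam = x (Fin.last N) :=
  ⟨h.choose, h.choose_spec, by rw [networkOutput, dif_pos h]⟩

/-- `Fin.ofNat` wraps indices beyond `N`, but the recursion only reads indices up to `N`. -/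
theorem IsNetworkState.isDiscreteState (hT : 0 < T) {N : ℕ} {A : ℝ → Mat m n} {α lam : ℝ → ℝ}
    {x : Fin (N + 1) → Vec n}
    (hx : IsNetworkState R T b x₀ (proj T N A) (proj T N α) (proj T N lam) x) :
    IsDiscreteState R (T / N) b x₀ N (cellMean (T / N) A) (cellMean (T / N) α)
      (cellMean (T / N) lam) (fun k => x (Fin.ofNat (N + 1) k)) := by
  refine ⟨by simpa using hx.1, fun k hk => ?_⟩
  have h1 : Fin.ofNat (N + 1) (k + 1) = (⟨k, hk⟩ : Fin N).succ :=
    Fin.ext (by simp [Nat.mod_eq_of_lt, hk])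
  have h2 : Fin.ofNat (N + 1) k = (⟨k, hk⟩ : Fin N).castSucc :=
    Fin.ext (by simp [Nat.mod_eq_of_lt, hk.trans (Nat.lt_succ_self N)])
  have := hx.2 ⟨k, hk⟩
  simp only [proj_eq_cellMean hT] at this
  simpa only [h1, h2] using this

theorem IsAdmissible.paramBound {A : ℝ → Mat m n} {α lam : ℝ → ℝ} (hT : 0 < T)
    (h : IsAdmissible T C A α lam) (N : ℕ) :
    ParamBound C N (cellMean (T / N) A) (cellMean (T / N) α) (cellMean (T / N) lam) := by
  intro k hk
  refine ⟨norm_cellMean_le hT h.meas_mat (h.bound.mono fun t ht => ht.1) hk,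
    ⟨cellMean_nonneg_of_ae hT (h.bound.mono fun t ht => ht.2.1.1) hk, ?_⟩,
    ⟨cellMean_nonneg_of_ae hT (h.bound.mono fun t ht => ht.2.2.1) hk, ?_⟩⟩
  · exact (le_abs_self _).trans (norm_cellMean_le hT h.meas_step
      (h.bound.mono fun t ht => by rw [Real.norm_eq_abs, abs_of_nonneg ht.2.1.1]; exact ht.2.1.2) hk)
  · exact (le_abs_self _).trans (norm_cellMean_le hT h.meas_reg
      (h.bound.mono fun t ht => by rw [Real.norm_eq_abs, abs_of_nonneg ht.2.2.1]; exact ht.2.2.2) hk)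

theorem IsAdmissible.existsUnique_isNetworkState {A : ℝ → Mat m n} {α lam : ℝ → ℝ} (hT : 0 < T)
    (h : IsAdmissible T C A α lam) (hR : ConvexOn ℝ univ R) (h0 : (0 : Vec n) ∈ subdiff R 0)
    (hne : ∀ w, (subdiff R w).Nonempty) (N : ℕ) :
    ∃! x : Fin (N + 1) → Vec n,
      IsNetworkState R T b x₀ (proj T N A) (proj T N α) (proj T N lam) x := by
  refine _root_.existsUnique_isNetworkState hR h0 hne hT.le (fun k => ?_) fun k => ?_
  · rw [proj_eq_cellMean hT]
    exact (h.paramBound hT N k k.2).2.1.1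
  · rw [proj_eq_cellMean hT]
    exact (h.paramBound hT N k k.2).2.2.1

/-- Along any ultrafilter, the outputs of networks with projections of `L¹`-convergent controls
converge to the terminal value of a solution of the limit system. -/
theorem exists_tendsto_networkOutput (hRc : ConvexOn ℝ univ R)
    (h0 : (0 : Vec n) ∈ subdiff R 0)
    (hgrowth : ∃ M : ℝ, 0 < M ∧ ∀ x : Vec n,
      (∀ z ∈ subdiff R x, ‖z‖ ≤ M * ‖x‖) ∨ (∀ z ∈ subdiff R x, ‖z‖ ≤ M))
    (hT : 0 < T) (hC : 0 ≤ C) {ι : Type*} (U : Ultrafilter ι) {N : ι → ℕ} (hN : ∀ i, 1 ≤ N i)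
    (hNU : Tendsto N U atTop) {A : ℝ → Mat m n} {α lam : ℝ → ℝ} (hadm : IsAdmissible T C A α lam)
    {a : ι → ℝ → Mat m n} {r l : ι → ℝ → ℝ} (hadm' : ∀ i, IsAdmissible T C (a i) (r i) (l i))
    (ha : Tendsto (fun i => ∫ t in Icc 0 T, ‖a i t - A t‖) U (𝓝 0))
    (hr : Tendsto (fun i => ∫ t in Icc 0 T, ‖r i t - α t‖) U (𝓝 0))
    (hl : Tendsto (fun i => ∫ t in Icc 0 T, ‖l i t - lam t‖) U (𝓝 0)) :
    ∃ x, IsLimitState R T b x₀ A α lam x ∧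
      Tendsto (fun i => networkOutput R T b x₀ (proj T (N i) (a i)) (proj T (N i) (r i))
        (proj T (N i) (l i))) U (𝓝 (x T)) := by
  have hne := subdiff_nonempty hRc h0 hgrowth
  obtain ⟨M, hM, hgrowth⟩ := hgrowth
  have hI : ∀ g : ℝ → ℝ, ∫ t in Icc 0 T, g t = ∫ t in 0..T, g t := fun g => by
    rw [intervalIntegral.integral_of_le hT.le, integral_Icc_eq_integral_Ioc]
  simp only [hI] at ha hr hl
  have hII : ∀ {E : Type} [NormedAddCommGroup E] {g : ℝ → E},
      AEStronglyMeasurable g (volume.restrict (Icc 0 T)) →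
      (∀ᵐ t ∂(volume.restrict (Icc 0 T)), ‖g t‖ ≤ C) → IntervalIntegrable g volume 0 T :=
    fun hg hgC =>
      (intervalIntegrable_iff_integrableOn_Icc_of_le hT.le).2 (Integrable.of_bound hg C hgC)
  have hA : ∀ {A : ℝ → Mat m n} {α lam : ℝ → ℝ}, IsAdmissible T C A α lam →
      IntervalIntegrable A volume 0 T := fun h => hII h.meas_mat (h.bound.mono fun t ht => ht.1)
  have hα : ∀ {A : ℝ → Mat m n} {α lam : ℝ → ℝ}, IsAdmissible T C A α lam →
      IntervalIntegrable α volume 0 T := fun h => hII h.meas_step (h.bound.mono fun t ht => by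
        rw [Real.norm_eq_abs, abs_of_nonneg ht.2.1.1]; exact ht.2.1.2)
  have hlam : ∀ {A : ℝ → Mat m n} {α lam : ℝ → ℝ}, IsAdmissible T C A α lam →
      IntervalIntegrable lam volume 0 T := fun h => hII h.meas_reg (h.bound.mono fun t ht => by
        rw [Real.norm_eq_abs, abs_of_nonneg ht.2.2.1]; exact ht.2.2.2)
  choose x hx hout using fun i => networkOutput_spec (R := R) (b := b) (x₀ := x₀)
    ((hadm' i).existsUnique_isNetworkState hT hRc h0 hne (N i)).exists
  obtain ⟨y, hy, hlim⟩ := exists_isLimitState_of_tendsto hRc h0 hne hM hgrowth hT hC hadm U hN hNU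
    (fun i => (hadm' i).paramBound hT (N i))
    (tendsto_integral_norm_stepFun_cellMean_sub_of_tendsto hT hN hNU (hA hadm)
      (fun i => hA (hadm' i)) ha)
    (tendsto_integral_norm_stepFun_cellMean_sub_of_tendsto hT hN hNU (hα hadm)
      (fun i => hα (hadm' i)) hr)
    (tendsto_integral_norm_stepFun_cellMean_sub_of_tendsto hT hN hNU (hlam hadm)
      (fun i => hlam (hadm' i)) hl)
    (fun i => (hx i).isDiscreteState hT)
  refine ⟨y, hy, hlim.congr fun i => ?_⟩
  rw [hout]
  congr 1
  exact Fin.ext (by simp)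

/-- Uniqueness makes the arbitrary choice in the definition harmless. -/
theorem limitOutput_eq {A : ℝ → Mat m n} {α lam : ℝ → ℝ} (hT : 0 < T)
    (hα : ∀ᵐ t ∂(volume.restrict (Icc 0 T)), 0 ≤ α t ∧ 0 ≤ lam t) {x : ℝ → Vec n}
    (hx : IsLimitState R T b x₀ A α lam x) : limitOutput R T b x₀ A α lam = x T := by
  have h : ∃ x, IsLimitState R T b x₀ A α lam x := ⟨x, hx⟩
  rw [limitOutput, dif_pos h]
  exact h.choose_spec.eqOn hT hα hx ⟨hT.le, le_rfl⟩

end Network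

/-! ### Components of `L^p` controls -/

section Controls

variable {m n : ℕ} {p : ℝ≥0∞} {T : ℝ}

namespace Param

theorem norm_matPart_le (v : Param m n) : ‖v.matPart‖ ≤ ‖v‖ := by
  rw [v.norm_eq]; linarith [abs_nonneg v.stepPart, abs_nonneg v.regPart]

theorem norm_stepPart_le (v : Param m n) : ‖v.stepPart‖ ≤ ‖v‖ := by
  rw [v.norm_eq, Real.norm_eq_abs]; linarith [norm_nonneg v.matPart, abs_nonneg v.regPart]

theorem norm_regPart_le (v : Param m n) : ‖v.regPart‖ ≤ ‖v‖ := by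
  rw [v.norm_eq, Real.norm_eq_abs]; linarith [norm_nonneg v.matPart, abs_nonneg v.stepPart]

theorem continuous_matPart : Continuous (matPart : Param m n → Mat m n) :=
  (LipschitzWith.of_dist_le_mul (K := 1) fun v w => by
    rw [NNReal.coe_one, one_mul, dist_eq_norm, dist_eq_norm]
    exact norm_matPart_le (v - w)).continuous

theorem continuous_stepPart : Continuous (stepPart : Param m n → ℝ) :=
  (LipschitzWith.of_dist_le_mul (K := 1) fun v w => by
    rw [NNReal.coe_one, one_mul, dist_eq_norm, dist_eq_norm]
    exact norm_stepPart_le (v - w)).continuous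

theorem continuous_regPart : Continuous (regPart : Param m n → ℝ) :=
  (LipschitzWith.of_dist_le_mul (K := 1) fun v w => by
    rw [NNReal.coe_one, one_mul, dist_eq_norm, dist_eq_norm]
    exact norm_regPart_le (v - w)).continuous

end Param

theorem Control.isAdmissible (u : Control m n p T) {C : ℝ}
    (hC : eLpNorm u ∞ (volume.restrict (Icc 0 T)) ≤ ENNReal.ofReal C)
    (hu : ∀ᵐ t ∂(volume.restrict (Icc 0 T)), 0 ≤ u.α t ∧ 0 ≤ u.lam t) :
    IsAdmissible T (max C 0) u.A u.α u.lam := by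
  have hm := Lp.aestronglyMeasurable u
  refine ⟨Param.continuous_matPart.comp_aestronglyMeasurable hm,
    Param.continuous_stepPart.comp_aestronglyMeasurable hm,
    Param.continuous_regPart.comp_aestronglyMeasurable hm, ?_⟩
  rw [eLpNorm_exponent_top] at hC
  filter_upwards [hu, ae_le_eLpNormEssSup (f := u) (μ := volume.restrict (Icc 0 T))]
    with t ht htC
  -- `ENNReal.ofReal` truncates a negative `C` to zero, hence the maximum.
  have hb : ‖u t‖ ≤ max C 0 := by
    have h1 := htC.trans hC
    rw [← ofReal_norm, ENNReal.ofReal_le_ofReal_iff'] at h1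
    rcases h1 with h1 | h1
    · exact h1.trans (le_max_left _ _)
    · exact h1.trans (le_max_right _ _)
  exact ⟨(Param.norm_matPart_le _).trans hb,
    ⟨ht.1, (le_abs_self _).trans ((Param.norm_stepPart_le _).trans hb)⟩,
    ⟨ht.2, (le_abs_self _).trans ((Param.norm_regPart_le _).trans hb)⟩⟩

/-- Hölder's inequality on a finite measure space: the `L¹` norm is at most a fixed finite multiple
of the `L^p` norm. -/
theorem Control.tendsto_integral_norm_sub [Fact (1 ≤ p)] {ι : Type*} {l : Filter ι}
    {v : ι → Control m n p T} {u : Control m n p T} (h : Tendsto v l (𝓝 u)) :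
    Tendsto (fun i => ∫ t in Icc 0 T, ‖v i t - u t‖) l (𝓝 0) := by
  set μ : Measure ℝ := volume.restrict (Icc 0 T) with hμ
  have h1 := (Lp.tendsto_Lp_iff_tendsto_eLpNorm' v u).1 h
  have h2 : Tendsto (fun i => eLpNorm (⇑(v i) - ⇑u) 1 μ) l (𝓝 0) := by
    have h3 : Tendsto (fun i => eLpNorm (⇑(v i) - ⇑u) p μ
        * μ univ ^ (1 / (1 : ℝ≥0∞).toReal - 1 / p.toReal)) l (𝓝 0) := by
      have hfin : μ univ ^ (1 / (1 : ℝ≥0∞).toReal - 1 / p.toReal) ≠ ∞ := by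
        refine ENNReal.rpow_ne_top_of_nonneg (sub_nonneg.2 ?_) (measure_ne_top _ _)
        rcases eq_or_ne p ∞ with rfl | hp
        · simp
        · have h1p : 1 ≤ p.toReal := by
            simpa using ENNReal.toReal_mono hp (Fact.out : 1 ≤ p)
          rw [ENNReal.toReal_one, div_one]
          exact (div_le_one (by linarith)).2 h1p
      simpa using ENNReal.Tendsto.mul_const h1 (Or.inr hfin)
    refine tendsto_of_tendsto_of_tendsto_of_le_of_le tendsto_const_nhds h3
      (fun i => zero_le) fun i => ?_
    exact eLpNorm_le_eLpNorm_mul_rpow_measure_univ (Fact.out : 1 ≤ p)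
      ((Lp.aestronglyMeasurable _).sub (Lp.aestronglyMeasurable _))
  have h4 := (ENNReal.tendsto_toReal ENNReal.zero_ne_top).comp h2
  refine h4.congr fun i => ?_
  rw [Function.comp_apply, eLpNorm_one_eq_lintegral_enorm]
  exact (integral_norm_eq_lintegral_enorm
    ((Lp.aestronglyMeasurable (v i)).sub (Lp.aestronglyMeasurable u))).symm

theorem tendsto_integral_norm_of_norm_le {E F ι : Type*} [NormedAddCommGroup E]
    [NormedAddCommGroup F] {Ω : Type*} [MeasurableSpace Ω] {μ : Measure Ω} {l : Filter ι}
    {f : ι → Ω → E} {g : ι → Ω → F} (hg : ∀ i, Integrable (g i) μ)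
    (hfg : ∀ i t, ‖f i t‖ ≤ ‖g i t‖) (h : Tendsto (fun i => ∫ t, ‖g i t‖ ∂μ) l (𝓝 0)) :
    Tendsto (fun i => ∫ t, ‖f i t‖ ∂μ) l (𝓝 0) :=
  squeeze_zero (fun _ => integral_nonneg fun _ => norm_nonneg _)
    (fun i => integral_mono_of_nonneg (Eventually.of_forall fun _ => norm_nonneg _) (hg i).norm
      (Eventually.of_forall (hfg i))) h

end Controls

/-! ### Assembly of the Γ-limit -/

/-- A `Γ`-limit of extended functionals on a closed set follows from convergence of the values along
convergent sequences in the set. -/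
theorem gammaConverges_extendTop {X : Type*} [TopologicalSpace X] [FirstCountableTopology X]
    {𝓕 : Set X} (h𝓕 : IsClosed 𝓕) {J : ℕ → X → ℝ} {J₀ : X → ℝ}
    (h : ∀ u ∈ 𝓕, ∀ v : ℕ → X, (∀ k, v k ∈ 𝓕) → Tendsto v atTop (𝓝 u) →
      Tendsto (fun k => J k (v k)) atTop (𝓝 (J₀ u))) :
    GammaConverges (fun k => extendTop 𝓕 (J k)) (extendTop 𝓕 J₀) := by
  classical
  refine ⟨fun u v hv => ?_, fun u => ⟨fun _ => u, tendsto_const_nhds, ?_⟩⟩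
  · by_cases hu : u ∈ 𝓕
    -- Terms outside `𝓕` have value `+∞`, so replacing them by `u` can only decrease the liminf and
    -- keeps convergence to `u`.
    · let w : ℕ → X := fun k => if v k ∈ 𝓕 then v k else u
      have hw : ∀ k, w k ∈ 𝓕 := fun k => by
        simp only [w]; split_ifs with hk <;> assumption
      have hwu : Tendsto w atTop (𝓝 u) := hv.if' tendsto_const_nhds
      have h1 : Tendsto (fun k => ((J k (w k) : ℝ) : EReal)) atTop (𝓝 ((J₀ u : ℝ) : EReal)) :=
        (continuous_coe_real_ereal.tendsto _).comp (h u hu w hw hwu)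
      have h2 : extendTop 𝓕 J₀ u = ((J₀ u : ℝ) : EReal) := if_pos hu
      rw [h2, ← h1.liminf_eq]
      refine liminf_le_liminf (Eventually.of_forall fun k => ?_)
      simp only [extendTop, w]
      split_ifs with hk
      · exact le_rfl
      · exact le_top
    -- Closedness of `𝓕` enters here: the sequence eventually leaves `𝓕`.
    · have h1 : (fun k => extendTop 𝓕 (J k) (v k)) =ᶠ[atTop] fun _ => (⊤ : EReal) := by
        filter_upwards [hv.eventually (h𝓕.isOpen_compl.mem_nhds hu)] with k hk
        exact if_neg hk
      rw [liminf_congr h1, liminf_const]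
      exact le_top
  · by_cases hu : u ∈ 𝓕
    · have h1 : Tendsto (fun k => ((J k u : ℝ) : EReal)) atTop (𝓝 ((J₀ u : ℝ) : EReal)) :=
        (continuous_coe_real_ereal.tendsto _).comp (h u hu _ (fun _ => hu) tendsto_const_nhds)
      simp only [extendTop, if_pos hu]
      exact h1.limsup_eq.le
    · simp only [extendTop, if_neg hu]
      exact le_top

theorem mainTheorem2 {m n : ℕ}
    -- the regularizer, the loss, the function `ψ`, and the assumptions on them
    (R : Vec n → ℝ) (L : Vec n → Vec n → ℝ) (ψ : ℝ → ℝ)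
    (hR_convex : ConvexOn ℝ univ R)
    (hR_zero : (0 : Vec n) ∈ subdiff R 0)
    (hR_growth : ∃ M : ℝ, 0 < M ∧ ∀ x : Vec n,
      (∀ z ∈ subdiff R x, ‖z‖ ≤ M * ‖x‖) ∨ (∀ z ∈ subdiff R x, ‖z‖ ≤ M))
    (hL_cont : Continuous (fun q : Vec n × Vec n => L q.1 q.2))
    (hL_nonneg : ∀ x z, 0 ≤ L x z)
    (hψ_lip : LocallyLipschitz ψ) (hψ_nonneg : ∀ s, 0 ≤ ψ s)
    -- weights, horizon, exponent `p ∈ [1, ∞)`, data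
    (β₁ β₂ β₃ : ℝ) (hβ₁ : 0 ≤ β₁) (hβ₂ : 0 ≤ β₂) (hβ₃ : 0 ≤ β₃)
    (T : ℝ) (hT : 0 < T) (p : ℝ≥0∞) [Fact (1 ≤ p)] (hp : p ≠ ∞)
    (b : Vec m) (x₀ y : Vec n)
    -- a nonempty set of controls, bounded in `L^∞`, closed in `L^p`, with `α, λ ≥ 0`
    (𝓕 : Set (Control m n p T)) (h𝓕_nonempty : 𝓕.Nonempty)
    (h𝓕_bdd : ∃ C : ℝ, ∀ u ∈ 𝓕,
      eLpNorm u ∞ (volume.restrict (Icc 0 T)) ≤ ENNReal.ofReal C)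
    (h𝓕_closed : IsClosed 𝓕)
    (h𝓕_nonneg : ∀ u ∈ 𝓕, ∀ᵐ t ∂(volume.restrict (Icc 0 T)), 0 ≤ u.α t ∧ 0 ≤ u.lam t) :
    -- the limit system has exactly one solution on `[0,T]` for every control in `𝓕`
    (∀ u ∈ 𝓕, ∃ x : ℝ → Vec n, IsLimitState R T b x₀ u.A u.α u.lam x ∧
      ∀ x', IsLimitState R T b x₀ u.A u.α u.lam x' → EqOn x' x (Icc 0 T)) ∧
    -- every network with projected parameters has exactly one state
    (∀ u ∈ 𝓕, ∀ N : ℕ, 1 ≤ N → ∃! x : Fin (N + 1) → Vec n,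
      IsNetworkState R T b x₀ (proj T N u.A) (proj T N u.α) (proj T N u.lam) x) ∧
    -- `Γ`-convergence in `L^p`; the `k`-th functional is the one for `N = k + 1` layers
    GammaConverges
      (fun k : ℕ => extendTop 𝓕 fun u : Control m n p T =>
        networkObjective R L ψ β₁ β₂ β₃ p.toReal T b x₀ y
          (proj T (k + 1) u.A) (proj T (k + 1) u.α) (proj T (k + 1) u.lam))
      (extendTop 𝓕 fun u : Control m n p T =>
        limitObjective R L ψ β₁ β₂ β₃ p.toReal T b x₀ y u.A u.α u.lam) := by

  have hp1 : 0 ≤ p.toReal := ENNReal.toReal_nonneg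
  obtain ⟨C₀, hC₀⟩ := h𝓕_bdd
  set C := max C₀ 0 with hCdef
  have hC : 0 ≤ C := le_max_right _ _
  have hadm : ∀ u ∈ 𝓕, IsAdmissible T C u.A u.α u.lam := fun u hu =>
    u.isAdmissible (hC₀ u hu) (h𝓕_nonneg u hu)
  have hne := subdiff_nonempty hR_convex hR_zero hR_growth
  have hL1 : ∀ {v : ℕ → Control m n p T} {u : Control m n p T} {l : Filter ℕ}, Tendsto v l (𝓝 u) →
      Tendsto (fun k => ∫ t in Icc 0 T, ‖(v k).A t - u.A t‖) l (𝓝 0) ∧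
      Tendsto (fun k => ∫ t in Icc 0 T, ‖(v k).α t - u.α t‖) l (𝓝 0) ∧
      Tendsto (fun k => ∫ t in Icc 0 T, ‖(v k).lam t - u.lam t‖) l (𝓝 0) := by
    intro v u l hvu
    have h1 := Control.tendsto_integral_norm_sub hvu
    have hint : ∀ k, Integrable (fun t => v k t - u t) (volume.restrict (Icc 0 T)) := fun k =>
      ((Lp.memLp (v k)).integrable Fact.out).sub ((Lp.memLp u).integrable Fact.out)
    exact ⟨tendsto_integral_norm_of_norm_le hint
        (fun k t => Param.norm_matPart_le (v k t - u t)) h1,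
      tendsto_integral_norm_of_norm_le hint
        (fun k t => Param.norm_stepPart_le (v k t - u t)) h1,
      tendsto_integral_norm_of_norm_le hint
        (fun k t => Param.norm_regPart_le (v k t - u t)) h1⟩
  have hNl : Tendsto (fun k : ℕ => k + 1) atTop atTop := tendsto_add_atTop_nat 1
  have hN : ∀ k : ℕ, 1 ≤ k + 1 := fun k => Nat.le_add_left 1 k
  have hultra : ∀ u ∈ 𝓕, ∀ v : ℕ → Control m n p T, (∀ k, v k ∈ 𝓕) →
      Tendsto v atTop (𝓝 u) → ∀ U : Ultrafilter ℕ, ↑U ≤ (atTop : Filter ℕ) →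
      ∃ x, IsLimitState R T b x₀ u.A u.α u.lam x ∧
        Tendsto (fun k => networkOutput R T b x₀ (proj T (k + 1) (v k).A)
          (proj T (k + 1) (v k).α) (proj T (k + 1) (v k).lam)) U (𝓝 (x T)) := by
    intro u hu v hv hvu U hU
    obtain ⟨h1, h2, h3⟩ := hL1 (hvu.mono_left hU)
    exact exists_tendsto_networkOutput hR_convex hR_zero hR_growth hT hC U hN
      (hNl.mono_left hU) (hadm u hu) (fun k => hadm (v k) (hv k)) h1 h2 h3
  refine ⟨fun u hu => ?_, fun u hu N _ =>
    (hadm u hu).existsUnique_isNetworkState hT hR_convex hR_zero hne N,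
    gammaConverges_extendTop h𝓕_closed fun u hu v hv hvu => ?_⟩
  -- Existence of the limit state: the networks built from the single control `u` converge along
  -- some ultrafilter.
  · obtain ⟨x, hx, -⟩ := hultra u hu (fun _ => u) (fun _ => hu) tendsto_const_nhds
      (Ultrafilter.of atTop) (Ultrafilter.of_le _)
    exact ⟨x, hx, fun x' hx' => hx'.eqOn hT (h𝓕_nonneg u hu) hx⟩
  · have hout : Tendsto (fun k => networkOutput R T b x₀ (proj T (k + 1) (v k).A)
        (proj T (k + 1) (v k).α) (proj T (k + 1) (v k).lam)) atTop
        (𝓝 (limitOutput R T b x₀ u.A u.α u.lam)) := by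
      -- Each ultrafilter finer than `atTop` produces some limit state; by uniqueness its terminal
      -- value is always `limitOutput`.
      rw [tendsto_iff_ultrafilter]
      intro U hU
      obtain ⟨x, hx, hlim⟩ := hultra u hu v hv hvu U hU
      rwa [limitOutput_eq hT (h𝓕_nonneg u hu) hx]
    have hLlim := (hL_cont.tendsto (limitOutput R T b x₀ u.A u.α u.lam, y)).comp
      (hout.prodMk_nhds tendsto_const_nhds)
    obtain ⟨h1, h2, h3⟩ := hL1 hvu
    have hψ := hψ_lip.continuous
    have hbα : ∀ u ∈ 𝓕, ∀ᵐ t ∂(volume.restrict (Icc 0 T)), ‖u.α t‖ ≤ C := fun u hu =>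
      (hadm u hu).bound.mono fun t ht => by
        rw [Real.norm_eq_abs, abs_of_nonneg ht.2.1.1]; exact ht.2.1.2
    have hbl : ∀ u ∈ 𝓕, ∀ᵐ t ∂(volume.restrict (Icc 0 T)), ‖u.lam t‖ ≤ C := fun u hu =>
      (hadm u hu).bound.mono fun t ht => by
        rw [Real.norm_eq_abs, abs_of_nonneg ht.2.2.1]; exact ht.2.2.2
    have hA := tendsto_discreteReg_proj hψ hp1 hT hN hNl (fun k => (hadm _ (hv k)).meas_mat)
      (hadm u hu).meas_mat (fun k => (hadm _ (hv k)).bound.mono fun t ht => ht.1)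
      ((hadm u hu).bound.mono fun t ht => ht.1) h1
    have hα := tendsto_discreteReg_proj hψ hp1 hT hN hNl (fun k => (hadm _ (hv k)).meas_step)
      (hadm u hu).meas_step (fun k => hbα _ (hv k)) (hbα u hu) h2
    have hl := tendsto_discreteReg_proj hψ hp1 hT hN hNl (fun k => (hadm _ (hv k)).meas_reg)
      (hadm u hu).meas_reg (fun k => hbl _ (hv k)) (hbl u hu) h3
    exact ((hLlim.add (hA.const_mul β₁)).add (hα.const_mul β₂)).add (hl.const_mul β₃)
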